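/- Let $I\subseteq\mathbb R$ be an open interval and let $X:I\to\mathbb R^2$ be a strictly locally convex plane curve, that is: $X$ is of class $C^3$ and regular; every $s\in I$ has an open subinterval $I_0\subseteq I$ around it such that for each $u\in I_0$ the arc $X(I_0)$ lies on one side of the tangent line at $X(u)$; and, with $N$ the unit normal pointing to the convex side (the side of the tangent line on which the curve lies locally), the curvature of $X$ with respect to $N$ is positive everywhere. For a point $P=X(s)$ of the curve and sufficiently small $h>0$, let $t$ be the tangent line of $X$ at $P$, let $\ell$ be the line through $P+hN(P)$ parallel to $t$, and let $A$ and $B$ be the points at which the curve, followed from $P$ in either direction, first meets $\ell$. Let $t_1,t_2$ be the tangent lines of $X$ at $A,B$, put $Q=t_1\cap t_2$, $A_1=t_1\cap t$, $B_1=t_2\cap t$, and let $k_P(h)$ be the distance from the centroid of the triangle $QA_1B_1$ to the line $\ell$. Then the following are equivalent. 1. There are real-valued functions $\lambda$ and $\mu$ on the curve such that for every $P$ one has $k_P(h)=\lambda(P)h^{\mu(P)}$ for all sufficiently small $h>0$. 2. For every $P$ one has $k_P(h)=\frac43 h$ for all sufficiently small $h>0$. 3. $X$ is an open part of a parabola,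 that is, $X(I)$ is a relatively open subset of some parabola. Here a point of the curve is understood together with its parameter (which matters only if $X$ intersects itself), and how small $h$ has to be may depend on $P$. -/

import Mathlib

open Set Filter Topology

noncomputable section

namespace CentroidParabola

/-- The Euclidean plane. -/
abbrev Plane : Type := EuclideanSpace ℝ (Fin 2)

/-- The line through `p` with direction vector `v` (used only for `v ≠ 0`). -/
def lineThrough (p v : Plane) : AffineSubspace ℝ Plane :=
  AffineSubspace.mk' p (Submodule.span ℝ {v})

/-- The tangent line of `X` at the parameter `s`. -/
def tangentLine (X : ℝ → Plane) (s : ℝ) : AffineSubspace ℝ Plane :=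
  lineThrough (X s) (deriv X s)

/-- `X` restricted to `J` is a convex curve: for every `s ∈ J` the trace `X(J)` lies in one of the
two closed half-planes bounded by the tangent line at `X s`. -/
def IsConvexCurveOn (X : ℝ → Plane) (J : Set ℝ) : Prop :=
  ∀ s ∈ J, ∃ n : Plane, n ≠ 0 ∧ inner ℝ (deriv X s) n = 0 ∧ ∀ u ∈ J, 0 ≤ inner ℝ (X u - X s) n

/-- `X` is locally convex on `I`: every parameter has an open subinterval around it on which the
curve is convex. -/
def IsLocallyConvexCurveOn (X : ℝ → Plane) (I : Set ℝ) : Prop :=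
  ∀ s ∈ I, ∃ a b : ℝ, s ∈ Ioo a b ∧ Ioo a b ⊆ I ∧ IsConvexCurveOn X (Ioo a b)

/-- `n` is the unit normal of `X` at `s` pointing to the convex side, that is, to the side of the
tangent line on which the curve lies near `s`. -/
structure IsConvexSideNormal (X : ℝ → Plane) (s : ℝ) (n : Plane) : Prop where
  norm_eq_one : ‖n‖ = 1
  inner_eq_zero : inner ℝ (deriv X s) n = 0
  convex_side : ∀ᶠ u in 𝓝 s, 0 ≤ inner ℝ (X u - X s) n

/-- The curvature of the regular curve `X` at `s` with respect to the unit normal `n`, for an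
arbitrary regular parametrization (for arc length it is `⟪X'' s, n⟫`). -/
def curvature (X : ℝ → Plane) (s : ℝ) (n : Plane) : ℝ :=
  inner ℝ (deriv (deriv X) s) n / ‖deriv X s‖ ^ 2

/-- `X` is a strictly locally convex curve on the open interval `I`, and `N` is its unit normal
pointing to the convex side. -/
structure IsStrictlyLocallyConvex (X : ℝ → Plane) (I : Set ℝ) (N : ℝ → Plane) : Prop where
  contDiffOn : ContDiffOn ℝ 3 X I
  regular : ∀ s ∈ I, deriv X s ≠ 0
  locallyConvex : IsLocallyConvexCurveOn X I
  normal : ∀ s ∈ I, IsConvexSideNormal X s (N s)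
  curvature_pos : ∀ s ∈ I, 0 < curvature X s (N s)

/-- The line `ℓ` through `P + h N(P)`, where `P = X s`, parallel to the tangent line at `P`. -/
def chordLine (X N : ℝ → Plane) (s h : ℝ) : AffineSubspace ℝ Plane :=
  lineThrough (X s + h • N s) (deriv X s)

/-- `A = X α` and `B = X β` are the end points of the chord that `ℓ` cuts off around `P = X s`:
the first points on either side of `P` at which the curve meets `ℓ`. -/
structure IsChord (X : ℝ → Plane) (I : Set ℝ) (N : ℝ → Plane) (s h α β : ℝ) : Prop where
  left_lt : α < s
  lt_right : s < β
  subset : Icc α β ⊆ I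
  left_mem : X α ∈ chordLine X N s h
  right_mem : X β ∈ chordLine X N s h
  notMem : ∀ u ∈ Ioo α β, X u ∉ chordLine X N s h

/-- `k_P(h) = k` for `P = X s`: with `t`, `t₁`, `t₂` the tangent lines at `P`, `A`, `B`, the lines
`t₁, t₂` meet in exactly one point `Q`, `t₁, t` in exactly one point `A₁`, `t₂, t` in exactly one
point `B₁`, and `k` is the distance from the centroid of the triangle `Q A₁ B₁` to `ℓ`.
At most one `k` has this property. -/
def IsCentroidDist (X : ℝ → Plane) (I : Set ℝ) (N : ℝ → Plane) (s h k : ℝ) : Prop :=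
  ∃ (α β : ℝ) (Q A₁ B₁ : Plane),
    IsChord X I N s h α β ∧
    (tangentLine X α : Set Plane) ∩ tangentLine X β = {Q} ∧
    (tangentLine X α : Set Plane) ∩ tangentLine X s = {A₁} ∧
    (tangentLine X β : Set Plane) ∩ tangentLine X s = {B₁} ∧
    k = Metric.infDist (Finset.univ.centroid ℝ ![Q, A₁, B₁]) (chordLine X N s h)

/-- A parabola: the points equidistant from a focus and a directrix not through the focus. -/
def IsParabola (S : Set Plane) : Prop :=
  ∃ F p v : Plane, v ≠ 0 ∧ F ∉ lineThrough p v ∧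
    S = {x | dist x F = Metric.infDist x (lineThrough p v)}

/-- The trace of `X` is an open part of a parabola, that is, a relatively open subset of one
(for an interval `I` the trace is connected). -/
def IsOpenPartOfParabola (X : ℝ → Plane) (I : Set ℝ) : Prop :=
  ∃ S U : Set Plane, IsParabola S ∧ IsOpen U ∧ X '' I = S ∩ U

end CentroidParabola

end

/-! At a point `X s`, use affine coordinates `(a, y)` in the frame of velocity and acceleration.
Near `s`, `a ~ u - s` and `y ~ (u - s)² / 2`. With `κ = ⟪X'' s, N s⟫`, the line at distance `h = κ
y` from the tangent is the level line of height `y`. Write `L(y)` for the difference of the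
`a`-coordinates of the chord ends. The tangents at the chord ends meet at height `y - L/L'`, while
`A₁` and `B₁` have height `0`. Averaging the heights gives `k = κ (2y/3 + L/(3L'))`
(`isCentroidDist_iff`).

From `L ~ 2√2 √y` and `L' ~ √2/√y` follows `k/h → 4/3`, so a power law for `k` can only be `4/3 *
h`. Moreover `k = 4/3 * h` is the equation `L = 2yL'`; with the asymptotics of `L` it is equivalent
to `L² = 8y` (`eventually_chordLength_sq_iff`). A parabola through the point, tangent to the
velocity and with the right second-order contact, is `(a + ρy)² = 2y`. Its chords satisfy `L² = 8y`,
which gives 3 → 2.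

For 2 → 3, the range of heights with `L² = 8y` depends on the point; Baire's theorem provides a
subinterval where it is uniform (`exists_eventually_hasParabolicChords`). There the point of
tangency may move while `y` stays fixed. Since `L` does not change, differentiation gives one more
relation. With `X''' = pX' + qX''`, it integrates to `(a_β + a_α)/2 = -(q/3) y`. Together with `a_β
- a_α = 2√(2y)` this is the parabola with `ρ = q/3` (`eventually_of_hasParabolicChords`). Finally,
if the curve runs along a parabola on one side of a point, the known chord length at that point puts
the other side on the same parabola (`eventually_of_left_or_right`), so the arc extends to all of
`I`. -/

namespace CentroidParabola

/-! ### Lines, distances and the equation of a parabola. -/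

/-- The standard area form of the plane. -/
def wedge (v w : Plane) : ℝ := v 0 * w 1 - v 1 * w 0

theorem wedge_self (v : Plane) : wedge v v = 0 := by simp only [wedge]; ring

theorem norm_sq_eq (v : Plane) : ‖v‖ ^ 2 = v 0 ^ 2 + v 1 ^ 2 := by
  rw [EuclideanSpace.real_norm_sq_eq, Fin.sum_univ_two]

theorem inner_eq (v w : Plane) : inner ℝ v w = v 0 * w 0 + v 1 * w 1 := by
  simp [PiLp.inner_apply, Fin.sum_univ_two, mul_comm]

theorem plane_ext {v w : Plane} (h0 : v 0 = w 0) (h1 : v 1 = w 1) : v = w := by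
  ext i; fin_cases i
  · exact h0
  · exact h1

theorem sq_add_sq_pos {v : Plane} (hv : v ≠ 0) : 0 < v 0 ^ 2 + v 1 ^ 2 := by
  rw [← norm_sq_eq]
  have := norm_pos_iff.2 hv
  positivity

theorem mem_lineThrough_iff_exists {p v x : Plane} :
    x ∈ lineThrough p v ↔ ∃ r : ℝ, x = p + r • v := by
  rw [lineThrough, AffineSubspace.mem_mk', Submodule.mem_span_singleton]
  constructor
  · rintro ⟨r, hr⟩
    exact ⟨r, by rw [hr]; simp⟩
  · rintro ⟨r, rfl⟩
    exact ⟨r, by simp⟩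

theorem mem_lineThrough_iff {p v x : Plane} (hv : v ≠ 0) :
    x ∈ lineThrough p v ↔ wedge v (x - p) = 0 := by
  rw [mem_lineThrough_iff_exists]
  constructor
  · rintro ⟨r, rfl⟩
    simp [wedge]; ring
  · intro h
    have hp := sq_add_sq_pos hv
    refine ⟨(v 0 * (x 0 - p 0) + v 1 * (x 1 - p 1)) / (v 0 ^ 2 + v 1 ^ 2), ?_⟩
    simp only [wedge, PiLp.sub_apply] at h
    apply plane_ext <;> simp only [PiLp.add_apply, PiLp.smul_apply, smul_eq_mul] <;> field_simp
    · linear_combination (-v 1) * h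
    · linear_combination v 0 * h

theorem infDist_lineThrough_eq_wedge {p v : Plane} (hv : v ≠ 0) (x : Plane) :
    Metric.infDist x (lineThrough p v) = |wedge v (x - p)| / ‖v‖ := by
  have hn : 0 < ‖v‖ := norm_pos_iff.2 hv
  have hp := sq_add_sq_pos hv
  have hns := norm_sq_eq v
  apply le_antisymm
  · set r := (v 0 * (x 0 - p 0) + v 1 * (x 1 - p 1)) / (v 0 ^ 2 + v 1 ^ 2) with hr
    have hm : p + r • v ∈ (lineThrough p v : Set Plane) := mem_lineThrough_iff_exists.2 ⟨r, rfl⟩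
    refine (Metric.infDist_le_dist_of_mem hm).trans (le_of_eq ?_)
    rw [dist_eq_norm, eq_div_iff hn.ne', ← abs_of_pos hn, ← abs_of_nonneg (norm_nonneg (x - _)),
      ← abs_mul, ← sq_eq_sq_iff_abs_eq_abs, mul_pow, hns, norm_sq_eq]
    simp only [wedge, PiLp.sub_apply, PiLp.add_apply, PiLp.smul_apply, smul_eq_mul, hr]
    field_simp
    ring
  · refine (Metric.le_infDist ⟨p, mem_lineThrough_iff_exists.2 ⟨0, by simp⟩⟩).2 ?_
    intro z hz
    obtain ⟨r, rfl⟩ := mem_lineThrough_iff_exists.1 hz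
    rw [dist_eq_norm, div_le_iff₀ hn, ← abs_of_pos hn, ← abs_of_nonneg (norm_nonneg (x - _)),
      ← abs_mul, ← sq_le_sq, mul_pow, hns, norm_sq_eq]
    simp only [wedge, PiLp.sub_apply, PiLp.add_apply, PiLp.smul_apply, smul_eq_mul]
    nlinarith [sq_nonneg (v 0 * (x 0 - (p 0 + r * v 0)) + v 1 * (x 1 - (p 1 + r * v 1)))]

theorem inter_lineThrough_eq_singleton {p q v w : Plane} (h : wedge v w ≠ 0) :
    (lineThrough p v : Set Plane) ∩ lineThrough q w =
      {p + (wedge (q - p) w / wedge v w) • v} := by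
  have hv : v ≠ 0 := by rintro rfl; simp [wedge] at h
  have hw : w ≠ 0 := by rintro rfl; simp [wedge] at h
  ext x
  simp only [mem_inter_iff, SetLike.mem_coe, mem_singleton_iff]
  constructor
  · rintro ⟨h1, h2⟩
    obtain ⟨r, rfl⟩ := mem_lineThrough_iff_exists.1 h1
    rw [mem_lineThrough_iff hw] at h2
    have : r = wedge (q - p) w / wedge v w := by
      rw [eq_div_iff h]
      simp only [wedge, PiLp.sub_apply, PiLp.add_apply, PiLp.smul_apply, smul_eq_mul] at h2 ⊢
      linear_combination -h2
    rw [this]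
  · rintro rfl
    refine ⟨mem_lineThrough_iff_exists.2 ⟨_, rfl⟩, ?_⟩
    rw [mem_lineThrough_iff hw]
    have : ∀ r : ℝ, wedge w (p + r • v - q) = wedge (q - p) w - r * wedge v w := by
      intro r
      simp only [wedge, PiLp.sub_apply, PiLp.add_apply, PiLp.smul_apply, smul_eq_mul]
      ring
    rw [this, div_mul_cancel₀ _ h, sub_self]

theorem centroid_triangle (P Q R : Plane) :
    Finset.univ.centroid ℝ ![P, Q, R] = (1 / 3 : ℝ) • (P + Q + R) := by
  rw [Finset.centroid_def, Finset.affineCombination_eq_linear_combination]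
  · simp [Fin.sum_univ_three, Finset.centroidWeights_apply]
  · exact Finset.sum_centroidWeights_eq_one_of_nonempty ℝ _ Finset.univ_nonempty

/-- A set is a parabola iff it is cut out by an equation `ℓ ^ 2 = m` with `ℓ` and `m` affine
functions with independent linear parts. -/
theorem isParabola_iff (S : Set Plane) :
    IsParabola S ↔ ∃ c₁ c₂ c₀ d₁ d₂ d₀ : ℝ, c₁ * d₂ - c₂ * d₁ ≠ 0 ∧
      S = {p | (c₁ * p 0 + c₂ * p 1 + c₀) ^ 2 = d₁ * p 0 + d₂ * p 1 + d₀} := by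
  have key : ∀ {p v : Plane}, v ≠ 0 → ∀ F x : Plane,
      dist x F = Metric.infDist x (lineThrough p v) ↔
        ((x 0 - F 0) ^ 2 + (x 1 - F 1) ^ 2) * (v 0 ^ 2 + v 1 ^ 2) =
          (v 0 * (x 1 - p 1) - v 1 * (x 0 - p 0)) ^ 2 := by
    intro p v hv F x
    have hn : 0 < ‖v‖ := norm_pos_iff.2 hv
    rw [infDist_lineThrough_eq_wedge hv, eq_div_iff hn.ne', dist_eq_norm, ← norm_sq_eq v]
    rw [← abs_of_nonneg (mul_nonneg (norm_nonneg (x - F)) hn.le), ← sq_eq_sq_iff_abs_eq_abs,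
      mul_pow, norm_sq_eq (x - F)]
    simp [wedge]
  constructor
  · rintro ⟨F, p, v, hv, hF, rfl⟩
    rw [mem_lineThrough_iff hv] at hF
    have hp := sq_add_sq_pos hv
    set g := wedge v (F - p) with hg
    -- Since `‖x - F‖²‖v‖² = ⟪v, x - F⟫² + (wedge v (x - F))²` and `wedge v (x - p) = wedge v (x -
    -- F) + g`, the focus-directrix equation is `⟪v, x - F⟫² = 2g · wedge v (x - F) + g²`.
    refine ⟨v 0, v 1, -(v 0 * F 0 + v 1 * F 1), -2 * g * v 1, 2 * g * v 0,
      - g * (v 0 * (p 1 + F 1) - v 1 * (p 0 + F 0)), ?_, ?_⟩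
    · have : v 0 * (2 * g * v 0) - v 1 * (-2 * g * v 1) = 2 * g * (v 0 ^ 2 + v 1 ^ 2) := by ring
      rw [this]
      exact mul_ne_zero (mul_ne_zero two_ne_zero hF) hp.ne'
    · ext x
      rw [mem_ofPred_eq, mem_ofPred_eq, key hv, hg]
      simp only [wedge, PiLp.sub_apply]
      constructor <;> intro h <;> linear_combination h
  · rintro ⟨c₁, c₂, c₀, d₁, d₂, d₀, hD, rfl⟩
    set R := c₁ ^ 2 + c₂ ^ 2 with hR
    set Δ := c₁ * d₂ - c₂ * d₁ with hΔ
    have hRpos : 0 < R := by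
      rcases eq_or_ne c₁ 0 with h | h
      · have : c₂ ≠ 0 := by rintro rfl; simp [hΔ, h] at hD
        positivity
      · positivity
    -- With `v = (c₁, c₂)` and `v⊥ = (-c₂, c₁)`, the component of `(d₁, d₂)` along `v` is absorbed
    -- by completing the square. The vertex is `f v + g v⊥`; focus and directrix lie at `±φ v⊥` from
    -- it.
    set f := -(2 * c₀ - (c₁ * d₁ + c₂ * d₂) / R) / (2 * R) with hf
    set g := (c₀ ^ 2 - d₀ - R ^ 2 * f ^ 2) / Δ with hg
    set φ := Δ / (4 * R ^ 2) with hφ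
    have hfR : 2 * R * f = -(2 * c₀ - (c₁ * d₁ + c₂ * d₂) / R) := by
      rw [hf]; field_simp
    have hgD : Δ * g = c₀ ^ 2 - d₀ - R ^ 2 * f ^ 2 := by rw [hg]; field_simp
    have hφR : 4 * R ^ 2 * φ = Δ := by rw [hφ]; field_simp
    have hφ0 : φ ≠ 0 := by rw [hφ]; positivity
    have hv : (!₂[c₁, c₂] : Plane) ≠ 0 := by
      intro h
      have h0 := congrArg (fun x : Plane => x 0) h
      have h1 := congrArg (fun x : Plane => x 1) h
      simp at h0 h1
      simp [hΔ, h0, h1] at hD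
    refine ⟨!₂[f * c₁ - (g + φ) * c₂, f * c₂ + (g + φ) * c₁],
      !₂[-(g - φ) * c₂, (g - φ) * c₁], !₂[c₁, c₂], hv, ?_, ?_⟩
    · rw [mem_lineThrough_iff hv]
      simp only [wedge, PiLp.sub_apply, Matrix.cons_val_zero, Matrix.cons_val_one]
      have : c₁ * (f * c₂ + (g + φ) * c₁ - (g - φ) * c₁) -
          c₂ * (f * c₁ - (g + φ) * c₂ - -(g - φ) * c₂) = 2 * R * φ := by rw [hR]; ring
      rw [this]
      positivity
    · ext x
      rw [mem_ofPred_eq, mem_ofPred_eq, key hv]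
      simp only [Matrix.cons_val_zero, Matrix.cons_val_one, ← hR]
      have e : (x 0 - (f * c₁ - (g + φ) * c₂)) ^ 2 * R + (x 1 - (f * c₂ + (g + φ) * c₁)) ^ 2 * R -
          (c₁ * (x 1 - (g - φ) * c₁) - c₂ * (x 0 - -(g - φ) * c₂)) ^ 2 =
          (c₁ * x 0 + c₂ * x 1 + c₀) ^ 2 - (d₁ * x 0 + d₂ * x 1 + d₀) := by
        have e1 : R * (d₁ * x 0 + d₂ * x 1) = (c₁ * d₁ + c₂ * d₂) * (c₁ * x 0 + c₂ * x 1) +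
            Δ * (c₁ * x 1 - c₂ * x 0) := by rw [hR, hΔ]; ring
        have e2 : (c₁ * d₁ + c₂ * d₂) = R * (2 * R * f + 2 * c₀) := by
          rw [hfR]; field_simp; ring
        have e3 : (x 0 - (f * c₁ - (g + φ) * c₂)) ^ 2 * R +
            (x 1 - (f * c₂ + (g + φ) * c₁)) ^ 2 * R -
            (c₁ * (x 1 - (g - φ) * c₁) - c₂ * (x 0 - -(g - φ) * c₂)) ^ 2 =
            (c₁ * x 0 + c₂ * x 1 - R * f) ^ 2 -
              4 * R * φ * (c₁ * x 1 - c₂ * x 0 - R * g) := by rw [hR]; ring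
        rw [e3]
        have := hRpos.ne'
        apply mul_left_cancel₀ this
        linear_combination e1 + (c₁ * x 0 + c₂ * x 1) * e2 - (c₁ * x 1 - c₂ * x 0) * hφR +
          R * hgD + R * g * hφR
      constructor
      · intro h; linarith
      · intro h; linarith

end CentroidParabola

/-! ### Local inverse branches of the height function. -/

namespace CentroidParabola

/-- The inverse of a function that vanishes at `s` and increases to the right of `s`. -/
theorem exists_right_branch {Y Y' : ℝ → ℝ} {s r : ℝ} (hr : s < r)
    (hY : ∀ u ∈ Icc s r, HasDerivAt Y (Y' u) u) (hpos : ∀ u ∈ Ioc s r, 0 < Y' u) (h0 : Y s = 0) :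
    ∃ y₁ : ℝ, 0 < y₁ ∧ ∃ β : ℝ → ℝ,
      (∀ y ∈ Ioo 0 y₁, β y ∈ Ioo s r ∧ Y (β y) = y ∧ HasDerivAt β (Y' (β y))⁻¹ y ∧
        ∀ u ∈ Ico s (β y), Y u < y) ∧
      Tendsto β (𝓝[>] 0) (𝓝 s) ∧ ∀ᶠ u in 𝓝[>] s, Y u ∈ Ioo 0 y₁ ∧ β (Y u) = u := by
  have hcont : ContinuousOn Y (Icc s r) := fun u hu => (hY u hu).continuousAt.continuousWithinAt
  have hmono : StrictMonoOn Y (Icc s r) := by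
    apply strictMonoOn_of_deriv_pos (convex_Icc s r) hcont
    intro u hu
    rw [interior_Icc] at hu
    rw [(hY u (Ioo_subset_Icc_self hu)).deriv]
    exact hpos u (Ioo_subset_Ioc_self hu)
  have hs : s ∈ Icc s r := left_mem_Icc.2 hr.le
  have hrr : r ∈ Icc s r := right_mem_Icc.2 hr.le
  have hy1 : 0 < Y r := h0 ▸ hmono hs hrr hr
  -- The implication makes the chosen inverse total; its values at other heights are irrelevant.
  have hex : ∀ y, ∃ u, y ∈ Ioo 0 (Y r) → u ∈ Ioo s r ∧ Y u = y := by
    intro y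
    by_cases hy : y ∈ Ioo 0 (Y r)
    · obtain ⟨u, hu, rfl⟩ := intermediate_value_Ioo hr.le hcont (by rwa [h0])
      exact ⟨u, fun _ => ⟨hu, rfl⟩⟩
    · exact ⟨0, fun h => absurd h hy⟩
  choose β hβ using hex
  have hβmem : ∀ y ∈ Ioo 0 (Y r), β y ∈ Icc s r := fun y hy => Ioo_subset_Icc_self (hβ y hy).1
  have hinv : ∀ u ∈ Ioo s r, Y u ∈ Ioo 0 (Y r) ∧ β (Y u) = u := by
    intro u hu
    have huI := Ioo_subset_Icc_self hu
    have hYu : Y u ∈ Ioo 0 (Y r) := ⟨h0 ▸ hmono hs huI hu.1, hmono huI hrr hu.2⟩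
    exact ⟨hYu, hmono.injOn (hβmem _ hYu) huI (hβ _ hYu).2⟩
  have hβmono : StrictMonoOn β (Ioo 0 (Y r)) := by
    intro y hy z hz hyz
    rw [← hmono.lt_iff_lt (hβmem y hy) (hβmem z hz), (hβ y hy).2, (hβ z hz).2]
    exact hyz
  have himage : β '' Ioo 0 (Y r) = Ioo s r := by
    ext u
    constructor
    · rintro ⟨y, hy, rfl⟩
      exact (hβ y hy).1
    · intro hu
      exact ⟨Y u, (hinv u hu).1, (hinv u hu).2⟩
  refine ⟨Y r, hy1, β, ?_, ?_, ?_⟩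
  · intro y hy
    refine ⟨(hβ y hy).1, (hβ y hy).2, ?_, ?_⟩
    · have hc : ContinuousAt β y := hβmono.continuousAt_of_image_mem_nhds
        (Ioo_mem_nhds hy.1 hy.2) (by
          rw [himage]; exact Ioo_mem_nhds (hβ y hy).1.1 (hβ y hy).1.2)
      refine HasDerivAt.of_local_left_inverse hc (hY _ (hβmem y hy))
        (hpos _ (Ioo_subset_Ioc_self (hβ y hy).1)).ne' ?_
      filter_upwards [Ioo_mem_nhds hy.1 hy.2] with z hz using (hβ z hz).2
    · intro u hu
      have : u ∈ Icc s r := ⟨hu.1, hu.2.le.trans (hβmem y hy).2⟩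
      have := hmono this (hβmem y hy) hu.2
      rwa [(hβ y hy).2] at this
  · rw [tendsto_order]
    constructor
    · intro b hb
      filter_upwards [Ioo_mem_nhdsGT hy1] with y hy using hb.trans (hβ y hy).1.1
    · intro b hb
      set c := min b ((s + r) / 2) with hc
      have hcm : c ∈ Ioo s r := ⟨lt_min hb (by linarith), (min_le_right _ _).trans_lt (by linarith)⟩
      filter_upwards [Ioo_mem_nhdsGT (hinv c hcm).1.1] with y hy
      have hy' : y ∈ Ioo 0 (Y r) := ⟨hy.1, hy.2.trans (hinv c hcm).1.2⟩
      have h := hβmono hy' (hinv c hcm).1 hy.2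
      rw [(hinv c hcm).2] at h
      exact h.trans_le (min_le_left _ _)
  · filter_upwards [Ioo_mem_nhdsGT hr] with u hu using hinv u hu

/-- The coordinates `(A, Y)` of a curve in the frame formed by its velocity and acceleration at
the parameter `s`, together with their derivatives. -/
structure OsculatingCoords (A A' Y Y' : ℝ → ℝ) (s : ℝ) : Prop where
  hasDerivAt_A : ∀ᶠ u in 𝓝 s, HasDerivAt A (A' u) u
  hasDerivAt_Y : ∀ᶠ u in 𝓝 s, HasDerivAt Y (Y' u) u
  continuousAt_A' : ContinuousAt A' s
  hasDerivAt_Y' : HasDerivAt Y' 1 s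
  A_self : A s = 0
  A'_self : A' s = 1
  Y_self : Y s = 0
  Y'_self : Y' s = 0

/-- `α` and `β` are the left and right inverse of `Y` near `s`, on heights in `(0, y₁)`. -/
structure ChordBranches (Y Y' : ℝ → ℝ) (U : Set ℝ) (s y₁ : ℝ) (α β : ℝ → ℝ) : Prop where
  pos : 0 < y₁
  left_lt : ∀ y ∈ Ioo 0 y₁, α y < s
  lt_right : ∀ y ∈ Ioo 0 y₁, s < β y
  subset : ∀ y ∈ Ioo 0 y₁, Icc (α y) (β y) ⊆ U
  apply_left : ∀ y ∈ Ioo 0 y₁, Y (α y) = y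
  apply_right : ∀ y ∈ Ioo 0 y₁, Y (β y) = y
  lt_of_mem : ∀ y ∈ Ioo 0 y₁, ∀ u ∈ Ioo (α y) (β y), Y u < y
  deriv_left_neg : ∀ y ∈ Ioo 0 y₁, Y' (α y) < 0
  deriv_right_pos : ∀ y ∈ Ioo 0 y₁, 0 < Y' (β y)
  hasDerivAt_left : ∀ y ∈ Ioo 0 y₁, HasDerivAt α (Y' (α y))⁻¹ y
  hasDerivAt_right : ∀ y ∈ Ioo 0 y₁, HasDerivAt β (Y' (β y))⁻¹ y
  tendsto_left : Tendsto α (𝓝[>] 0) (𝓝 s)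
  tendsto_right : Tendsto β (𝓝[>] 0) (𝓝 s)
  left_inv : ∀ᶠ u in 𝓝[<] s, Y u ∈ Ioo 0 y₁ ∧ α (Y u) = u
  right_inv : ∀ᶠ u in 𝓝[>] s, Y u ∈ Ioo 0 y₁ ∧ β (Y u) = u

namespace OsculatingCoords

variable {A A' Y Y' : ℝ → ℝ} {s : ℝ}

theorem tendsto_A_div (h : OsculatingCoords A A' Y Y' s) :
    Tendsto (fun u => A u / (u - s)) (𝓝[≠] s) (𝓝 1) := by
  have := h.hasDerivAt_A.self_of_nhds.tendsto_slope
  rw [h.A'_self] at this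
  refine this.congr fun u => ?_
  rw [slope_def_field, h.A_self, sub_zero]

theorem tendsto_Y'_div (h : OsculatingCoords A A' Y Y' s) :
    Tendsto (fun u => Y' u / (u - s)) (𝓝[≠] s) (𝓝 1) := by
  refine h.hasDerivAt_Y'.tendsto_slope.congr fun u => ?_
  rw [slope_def_field, h.Y'_self, sub_zero]

theorem tendsto_Y_div (h : OsculatingCoords A A' Y Y' s) :
    Tendsto (fun u => Y u / (u - s) ^ 2) (𝓝[≠] s) (𝓝 (1 / 2)) := by
  refine HasDerivAt.lhopital_zero_nhdsNE (f' := Y') (g' := fun u => 2 * (u - s))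
    (h.hasDerivAt_Y.filter_mono nhdsWithin_le_nhds) ?_ ?_ ?_ ?_ ?_
  · refine Eventually.of_forall fun u => ?_
    simpa using ((hasDerivAt_id' u).sub_const s).fun_pow 2
  · filter_upwards [self_mem_nhdsWithin] with u hu
    exact mul_ne_zero two_ne_zero (sub_ne_zero.2 hu)
  · have := h.hasDerivAt_Y.self_of_nhds.continuousAt.tendsto
    rw [h.Y_self] at this
    exact this.mono_left nhdsWithin_le_nhds
  · have : ContinuousAt (fun u : ℝ => (u - s) ^ 2) s := by fun_prop
    have := this.tendsto
    simp only [sub_self, ne_eq, OfNat.ofNat_ne_zero, not_false_eq_true, zero_pow] at this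
    exact this.mono_left nhdsWithin_le_nhds
  · have := h.tendsto_Y'_div.div_const 2
    refine this.congr fun u => ?_
    rw [div_div, mul_comm]

theorem exists_chordBranches (h : OsculatingCoords A A' Y Y' s) {U : Set ℝ} (hU : U ∈ 𝓝 s) :
    ∃ y₁ α β, ChordBranches Y Y' U s y₁ α β := by
  have hev : ∀ᶠ u in 𝓝 s, u ∈ U ∧ HasDerivAt Y (Y' u) u ∧ (u ≠ s → 0 < Y' u / (u - s)) := by
    filter_upwards [hU, h.hasDerivAt_Y,
      eventually_nhdsWithin_iff.1 (h.tendsto_Y'_div.eventually_const_lt zero_lt_one)] with u h1 h2 h3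
    exact ⟨h1, h2, h3⟩
  obtain ⟨ε, hε, hball⟩ := Metric.eventually_nhds_iff.1 hev
  have hgood : ∀ u, |u - s| < ε → u ∈ U ∧ HasDerivAt Y (Y' u) u ∧ (u ≠ s → 0 < Y' u / (u - s)) :=
    fun u hu => hball (by rwa [Real.dist_eq])
  have hr : ∀ u ∈ Icc s (s + ε / 2), |u - s| < ε := fun u hu => by
    rw [abs_lt]; constructor <;> linarith [hu.1, hu.2]
  have hl : ∀ u ∈ Icc (-s) (-s + ε / 2), |-u - s| < ε := fun u hu => by
    rw [abs_lt]; constructor <;> linarith [hu.1, hu.2]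
  have hposr : ∀ u ∈ Ioc s (s + ε / 2), 0 < Y' u := fun u hu => by
    have := (hgood u (hr u (Ioc_subset_Icc_self hu))).2.2 hu.1.ne'
    rwa [div_pos_iff_of_pos_right (sub_pos.2 hu.1)] at this
  have hnegl : ∀ u ∈ Ioc (-s) (-s + ε / 2), Y' (-u) < 0 := fun u hu => by
    have := (hgood (-u) (hl u (Ioc_subset_Icc_self hu))).2.2 (by linarith [hu.1])
    rcases div_pos_iff.1 this with h | h
    · linarith [h.2, hu.1]
    · exact h.1
  obtain ⟨y₁, hy₁, β, hβ, hβt, hβi⟩ := exists_right_branch (by linarith : s < s + ε / 2)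
    (fun u hu => (hgood u (hr u hu)).2.1) hposr h.Y_self
  -- The left branch is minus the right branch of the reflected function `u ↦ Y (-u)` at `-s`.
  obtain ⟨y₂, hy₂, γ, hγ, hγt, hγi⟩ := exists_right_branch (Y := fun u => Y (-u))
    (Y' := fun u => -Y' (-u)) (by linarith : -s < -s + ε / 2)
    (fun u hu => by
      have := (hgood (-u) (hl u hu)).2.1.comp u (hasDerivAt_neg u)
      simpa [Function.comp_def] using this)
    (fun u hu => by have := hnegl u hu; linarith) (by simpa using h.Y_self)
  have hm : ∀ y ∈ Ioo 0 (min y₁ y₂), y ∈ Ioo 0 y₁ ∧ y ∈ Ioo 0 y₂ := fun y hy =>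
    ⟨⟨hy.1, hy.2.trans_le (min_le_left _ _)⟩, ⟨hy.1, hy.2.trans_le (min_le_right _ _)⟩⟩
  have hYlt : ∀ᶠ u in 𝓝 s, Y u < min y₁ y₂ := by
    have := h.hasDerivAt_Y.self_of_nhds.continuousAt.tendsto
    rw [h.Y_self] at this
    exact this.eventually_lt_const (lt_min hy₁ hy₂)
  refine ⟨min y₁ y₂, fun y => -γ y, β, lt_min hy₁ hy₂, ?_, ?_, ?_, ?_, ?_, ?_, ?_, ?_, ?_, ?_, ?_,
    hβt, ?_, ?_⟩
  · intro y hy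
    have := (hγ y (hm y hy).2).1.1
    linarith
  · intro y hy
    exact (hβ y (hm y hy).1).1.1
  · intro y hy u hu
    have h1 := (hγ y (hm y hy).2).1.2
    have h2 := (hβ y (hm y hy).1).1.2
    refine (hgood u ?_).1
    rw [abs_lt]; constructor <;> linarith [hu.1, hu.2]
  · intro y hy
    exact (hγ y (hm y hy).2).2.1
  · intro y hy
    exact (hβ y (hm y hy).1).2.1
  · intro y hy u hu
    rcases le_total s u with hsu | hsu
    · exact (hβ y (hm y hy).1).2.2.2 u ⟨hsu, hu.2⟩
    · have := (hγ y (hm y hy).2).2.2.2 (-u) ⟨by linarith, by linarith [hu.1]⟩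
      simpa using this
  · intro y hy
    exact hnegl _ (Ioo_subset_Ioc_self (hγ y (hm y hy).2).1)
  · intro y hy
    exact hposr _ (Ioo_subset_Ioc_self (hβ y (hm y hy).1).1)
  · intro y hy
    have := (hγ y (hm y hy).2).2.2.1.neg
    rwa [inv_neg, neg_neg] at this
  · intro y hy
    exact (hβ y (hm y hy).1).2.2.1
  · simpa using hγt.neg
  · have hneg : Tendsto (fun u : ℝ => -u) (𝓝[<] s) (𝓝[>] (-s)) := by
      apply tendsto_nhdsWithin_of_tendsto_nhds_of_eventually_within
      · exact (continuous_neg.tendsto s).mono_left nhdsWithin_le_nhds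
      · filter_upwards [self_mem_nhdsWithin] with u hu
        exact mem_Ioi.2 (neg_lt_neg (mem_Iio.1 hu))
    filter_upwards [hneg.eventually hγi, hYlt.filter_mono nhdsWithin_le_nhds] with u hu hu'
    rw [neg_neg] at hu
    exact ⟨⟨hu.1.1, hu'⟩, by rw [hu.2, neg_neg]⟩
  · filter_upwards [hβi, hYlt.filter_mono nhdsWithin_le_nhds] with u hu hu'
    exact ⟨⟨hu.1.1, hu'⟩, hu.2⟩

end OsculatingCoords

end CentroidParabola

/-! ### Asymptotics of the chord length and its differential equation. -/

namespace CentroidParabola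

noncomputable section

/-- The length of the chord at height `y`, measured along the velocity vector. -/
def chordLength (A α β : ℝ → ℝ) (y : ℝ) : ℝ := A (β y) - A (α y)

/-- The derivative of `chordLength`. -/
def chordRate (A' Y' α β : ℝ → ℝ) (y : ℝ) : ℝ := A' (β y) / Y' (β y) - A' (α y) / Y' (α y)

namespace ChordBranches

variable {A A' Y Y' : ℝ → ℝ} {U : Set ℝ} {s y₁ : ℝ} {α β : ℝ → ℝ}

theorem eventually_mem (B : ChordBranches Y Y' U s y₁ α β) : ∀ᶠ y in 𝓝[>] 0, y ∈ Ioo 0 y₁ :=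
  Ioo_mem_nhdsGT B.pos

theorem tendsto_left' (B : ChordBranches Y Y' U s y₁ α β) : Tendsto α (𝓝[>] 0) (𝓝[<] s) :=
  tendsto_nhdsWithin_of_tendsto_nhds_of_eventually_within _ B.tendsto_left
    (B.eventually_mem.mono B.left_lt)

theorem tendsto_right' (B : ChordBranches Y Y' U s y₁ α β) : Tendsto β (𝓝[>] 0) (𝓝[>] s) :=
  tendsto_nhdsWithin_of_tendsto_nhds_of_eventually_within _ B.tendsto_right
    (B.eventually_mem.mono B.lt_right)

theorem tendsto_left_ne (B : ChordBranches Y Y' U s y₁ α β) : Tendsto α (𝓝[>] 0) (𝓝[≠] s) :=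
  B.tendsto_left'.mono_right (nhdsWithin_mono _ fun _ h => ne_of_lt h)

theorem tendsto_right_ne (B : ChordBranches Y Y' U s y₁ α β) : Tendsto β (𝓝[>] 0) (𝓝[≠] s) :=
  B.tendsto_right'.mono_right (nhdsWithin_mono _ fun _ h => ne_of_gt h)

end ChordBranches

namespace OsculatingCoords

variable {A A' Y Y' : ℝ → ℝ} {U : Set ℝ} {s y₁ : ℝ} {α β : ℝ → ℝ}

/-- Inverting `Y u ~ (u - s)² / 2` gives `|u - s| ~ √(2y)` along either branch. -/
theorem tendsto_abs_sub_div_sqrt (h : OsculatingCoords A A' Y Y' s) {γ : ℝ → ℝ}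
    (hγ : Tendsto γ (𝓝[>] 0) (𝓝[≠] s)) (hYγ : ∀ᶠ y in 𝓝[>] 0, Y (γ y) = y) :
    Tendsto (fun y => |γ y - s| / √y) (𝓝[>] 0) (𝓝 √2) := by
  have h1 := ((h.tendsto_Y_div.comp hγ).inv₀ (by norm_num)).sqrt
  rw [one_div, inv_inv] at h1
  refine h1.congr' ?_
  filter_upwards [hYγ, self_mem_nhdsWithin] with y hy hy0
  have : (0 : ℝ) ≤ y := le_of_lt hy0
  simp only [Function.comp_apply, hy, inv_div]
  rw [Real.sqrt_div' _ this, Real.sqrt_sq_eq_abs]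

theorem tendsto_left_sub_div_sqrt (h : OsculatingCoords A A' Y Y' s)
    (B : ChordBranches Y Y' U s y₁ α β) :
    Tendsto (fun y => (α y - s) / √y) (𝓝[>] 0) (𝓝 (-√2)) := by
  refine (h.tendsto_abs_sub_div_sqrt B.tendsto_left_ne
    (B.eventually_mem.mono B.apply_left)).neg.congr' ?_
  filter_upwards [B.eventually_mem] with y hy
  rw [abs_of_neg (sub_neg.2 (B.left_lt y hy)), neg_div, neg_neg]

theorem tendsto_right_sub_div_sqrt (h : OsculatingCoords A A' Y Y' s)
    (B : ChordBranches Y Y' U s y₁ α β) :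
    Tendsto (fun y => (β y - s) / √y) (𝓝[>] 0) (𝓝 √2) := by
  refine (h.tendsto_abs_sub_div_sqrt B.tendsto_right_ne
    (B.eventually_mem.mono B.apply_right)).congr' ?_
  filter_upwards [B.eventually_mem] with y hy
  rw [abs_of_pos (sub_pos.2 (B.lt_right y hy))]

theorem tendsto_comp_div_sqrt {F γ : ℝ → ℝ} {c : ℝ}
    (hF : Tendsto (fun u => F u / (u - s)) (𝓝[≠] s) (𝓝 1)) (hγ : Tendsto γ (𝓝[>] 0) (𝓝[≠] s))
    (hc : Tendsto (fun y => (γ y - s) / √y) (𝓝[>] 0) (𝓝 c)) :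
    Tendsto (fun y => F (γ y) / √y) (𝓝[>] 0) (𝓝 c) := by
  have h1 := (hF.comp hγ).mul hc
  rw [one_mul] at h1
  refine h1.congr' ?_
  filter_upwards [hγ.eventually self_mem_nhdsWithin] with y hy
  have : γ y - s ≠ 0 := sub_ne_zero.2 hy
  simp only [Function.comp_apply]
  rw [div_mul_div_cancel₀ this]

theorem tendsto_chordLength_div_sqrt (h : OsculatingCoords A A' Y Y' s)
    (B : ChordBranches Y Y' U s y₁ α β) :
    Tendsto (fun y => chordLength A α β y / √y) (𝓝[>] 0) (𝓝 (2 * √2)) := by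
  have hl := tendsto_comp_div_sqrt h.tendsto_A_div B.tendsto_left_ne (h.tendsto_left_sub_div_sqrt B)
  have hr := tendsto_comp_div_sqrt h.tendsto_A_div B.tendsto_right_ne
    (h.tendsto_right_sub_div_sqrt B)
  have := hr.sub hl
  rw [sub_neg_eq_add, ← two_mul] at this
  refine this.congr fun y => ?_
  rw [chordLength, sub_div]

theorem tendsto_chordRate_mul_sqrt (h : OsculatingCoords A A' Y Y' s)
    (B : ChordBranches Y Y' U s y₁ α β) :
    Tendsto (fun y => chordRate A' Y' α β y * √y) (𝓝[>] 0) (𝓝 √2) := by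
  have hl := tendsto_comp_div_sqrt h.tendsto_Y'_div B.tendsto_left_ne
    (h.tendsto_left_sub_div_sqrt B)
  have hr := tendsto_comp_div_sqrt h.tendsto_Y'_div B.tendsto_right_ne
    (h.tendsto_right_sub_div_sqrt B)
  have hA : Tendsto A' (𝓝 s) (𝓝 1) := by simpa [h.A'_self] using h.continuousAt_A'.tendsto
  have h2 : √2 ≠ 0 := by positivity
  have := ((hA.comp B.tendsto_right).div hr h2).sub
    ((hA.comp B.tendsto_left).div hl (neg_ne_zero.2 h2))
  have e : 1 / √2 - 1 / -√2 = √2 := by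
    rw [one_div_neg_eq_neg_one_div, sub_neg_eq_add]
    field_simp
    norm_num
  rw [e] at this
  refine this.congr fun y => ?_
  simp only [Function.comp_apply, chordRate, Pi.div_apply, div_div_eq_mul_div]
  ring

theorem eventually_chordRate_pos (h : OsculatingCoords A A' Y Y' s)
    (B : ChordBranches Y Y' U s y₁ α β) : ∀ᶠ y in 𝓝[>] 0, 0 < chordRate A' Y' α β y := by
  filter_upwards [(h.tendsto_chordRate_mul_sqrt B).eventually_const_lt
    (by positivity : (0 : ℝ) < √2), self_mem_nhdsWithin] with y hy hy0
  exact pos_of_mul_pos_left hy (Real.sqrt_nonneg y)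

theorem eventually_chordLength_pos (h : OsculatingCoords A A' Y Y' s)
    (B : ChordBranches Y Y' U s y₁ α β) : ∀ᶠ y in 𝓝[>] 0, 0 < chordLength A α β y := by
  filter_upwards [(h.tendsto_chordLength_div_sqrt B).eventually_const_lt
    (by positivity : (0 : ℝ) < 2 * √2), self_mem_nhdsWithin] with y hy hy0
  rwa [div_pos_iff_of_pos_right (Real.sqrt_pos.2 hy0)] at hy

theorem tendsto_chordLength_div_chordRate (h : OsculatingCoords A A' Y Y' s)
    (B : ChordBranches Y Y' U s y₁ α β) :
    Tendsto (fun y => chordLength A α β y / chordRate A' Y' α β y / y) (𝓝[>] 0) (𝓝 2) := by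
  have h2 : √2 ≠ 0 := by positivity
  have := (h.tendsto_chordLength_div_sqrt B).div (h.tendsto_chordRate_mul_sqrt B) h2
  rw [mul_div_cancel_right₀ _ h2] at this
  refine this.congr' ?_
  filter_upwards [self_mem_nhdsWithin] with y hy0
  have hy : (0 : ℝ) < y := hy0
  simp only [Pi.div_apply]
  rw [div_div, div_div, mul_comm (chordRate A' Y' α β y), ← mul_assoc, Real.mul_self_sqrt hy.le,
    mul_comm y]

theorem eventually_hasDerivAt_left (h : OsculatingCoords A A' Y Y' s)
    (B : ChordBranches Y Y' U s y₁ α β) :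
    ∀ᶠ y in 𝓝[>] 0, HasDerivAt (fun y => A (α y)) (A' (α y) / Y' (α y)) y := by
  filter_upwards [B.tendsto_left.eventually h.hasDerivAt_A, B.eventually_mem] with y hy hy'
  exact hy.comp y (B.hasDerivAt_left y hy')

theorem eventually_hasDerivAt_right (h : OsculatingCoords A A' Y Y' s)
    (B : ChordBranches Y Y' U s y₁ α β) :
    ∀ᶠ y in 𝓝[>] 0, HasDerivAt (fun y => A (β y)) (A' (β y) / Y' (β y)) y := by
  filter_upwards [B.tendsto_right.eventually h.hasDerivAt_A, B.eventually_mem] with y hy hy'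
  exact hy.comp y (B.hasDerivAt_right y hy')

theorem eventually_hasDerivAt_chordLength (h : OsculatingCoords A A' Y Y' s)
    (B : ChordBranches Y Y' U s y₁ α β) :
    ∀ᶠ y in 𝓝[>] 0, HasDerivAt (chordLength A α β) (chordRate A' Y' α β y) y := by
  filter_upwards [h.eventually_hasDerivAt_left B, h.eventually_hasDerivAt_right B] with y hl hr
  exact hr.sub hl

/-- A function with zero derivative to the right of `0` is equal to its limit at `0`. -/
theorem eventually_eq_of_hasDerivAt_zero {f : ℝ → ℝ} {c : ℝ}
    (hf : ∀ᶠ y in 𝓝[>] (0 : ℝ), HasDerivAt f 0 y) (hc : Tendsto f (𝓝[>] 0) (𝓝 c)) :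
    ∀ᶠ y in 𝓝[>] (0 : ℝ), f y = c := by
  obtain ⟨ε, hε, hsub⟩ := mem_nhdsGT_iff_exists_Ioo_subset.1 hf
  have hε' : (0 : ℝ) < ε := hε
  have hconst : ∀ y ∈ Ioo 0 ε, ∀ z ∈ Ioo 0 ε, f y = f z := by
    intro y hy z hz
    refine isOpen_Ioo.is_const_of_deriv_eq_zero isPreconnected_Ioo
      (fun w hw => (hsub hw).differentiableAt.differentiableWithinAt)
      (fun w hw => (hsub hw).deriv) hy hz
  filter_upwards [Ioo_mem_nhdsGT hε'] with y hy
  refine tendsto_nhds_unique (tendsto_const_nhds.congr' ?_) hc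
  filter_upwards [Ioo_mem_nhdsGT hε'] with z hz using hconst y hy z hz

/-- The derivative of `L²/y` vanishes where `L = 2yL'`, and `L²/y` tends to `(2√2)² = 8`;
conversely, differentiating `L² = 8y` and cancelling `L > 0` returns the differential equation. -/
theorem eventually_chordLength_sq_iff (h : OsculatingCoords A A' Y Y' s)
    (B : ChordBranches Y Y' U s y₁ α β) :
    (∀ᶠ y in 𝓝[>] 0, chordLength A α β y ^ 2 = 8 * y) ↔
      ∀ᶠ y in 𝓝[>] 0, chordLength A α β y = 2 * y * chordRate A' Y' α β y := by
  constructor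
  · intro hsq
    filter_upwards [eventually_eventually_nhdsWithin.2 hsq, h.eventually_hasDerivAt_chordLength B,
      h.eventually_chordLength_pos B, self_mem_nhdsWithin] with y hy hd hpos hy0
    have hev : (fun z => chordLength A α β z ^ 2) =ᶠ[𝓝 y] fun z => 8 * z := by
      rwa [nhdsWithin_eq_nhds.2 (Ioi_mem_nhds hy0)] at hy
    have h1 := (hd.fun_pow 2).unique
      (((hasDerivAt_id' y).const_mul (8 : ℝ)).congr_of_eventuallyEq hev)
    have h2 := hev.self_of_nhds
    simp only at h2
    have h3 : chordLength A α β y * (2 * y * chordRate A' Y' α β y - chordLength A α β y) = 0 := by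
      norm_num at h1
      linear_combination y * h1 - h2
    rcases mul_eq_zero.1 h3 with h4 | h4
    · exact absurd h4 hpos.ne'
    · linarith
  · intro hode
    have hd : ∀ᶠ y in 𝓝[>] 0, HasDerivAt (fun y => chordLength A α β y ^ 2 / y) 0 y := by
      filter_upwards [hode, h.eventually_hasDerivAt_chordLength B, self_mem_nhdsWithin]
        with y hy hd hy0
      have hy0' : y ≠ 0 := ne_of_gt hy0
      refine ((hd.fun_pow 2).fun_div (hasDerivAt_id' y) hy0').congr_deriv ?_
      rw [div_eq_zero_iff]
      left
      norm_num
      linear_combination -(chordLength A α β y) * hy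
    have hlim : Tendsto (fun y => chordLength A α β y ^ 2 / y) (𝓝[>] 0) (𝓝 8) := by
      have := (h.tendsto_chordLength_div_sqrt B).pow 2
      rw [mul_pow, Real.sq_sqrt (by norm_num)] at this
      norm_num at this
      refine this.congr' ?_
      filter_upwards [self_mem_nhdsWithin] with y hy0
      rw [div_pow, Real.sq_sqrt (le_of_lt hy0)]
    filter_upwards [eventually_eq_of_hasDerivAt_zero hd hlim, self_mem_nhdsWithin] with y hy hy0
    rwa [div_eq_iff (ne_of_gt hy0)] at hy

end OsculatingCoords

end

end CentroidParabola

/-! ### The affine frame of a curve and its relation to the Euclidean data. -/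

namespace CentroidParabola

noncomputable section

theorem hasDerivAt_coord {f : ℝ → Plane} {f' : Plane} {t : ℝ} (hf : HasDerivAt f f' t) (i : Fin 2) :
    HasDerivAt (fun u => f u i) (f' i) t :=
  (EuclideanSpace.proj (𝕜 := ℝ) i).hasFDerivAt.comp_hasDerivAt t hf

theorem hasDerivAt_wedge {f g : ℝ → Plane} {f' g' : Plane} {t : ℝ} (hf : HasDerivAt f f' t)
    (hg : HasDerivAt g g' t) : HasDerivAt (fun u => wedge (f u) (g u))
      (wedge f' (g t) + wedge (f t) g') t := by
  refine (((hasDerivAt_coord hf 0).fun_mul (hasDerivAt_coord hg 1)).fun_sub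
    ((hasDerivAt_coord hf 1).fun_mul (hasDerivAt_coord hg 0))).congr_deriv ?_
  simp only [wedge]
  ring

/-- The component of a vector along the velocity of `X` at `s`, in the frame of velocity and
acceleration. -/
def tangentPart (X : ℝ → Plane) (s : ℝ) (v : Plane) : ℝ :=
  wedge v (deriv (deriv X) s) / wedge (deriv X s) (deriv (deriv X) s)

/-- The component of a vector along the acceleration of `X` at `s`, in the frame of velocity and
acceleration. -/
def heightPart (X : ℝ → Plane) (s : ℝ) (v : Plane) : ℝ :=
  wedge (deriv X s) v / wedge (deriv X s) (deriv (deriv X) s)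

/-- The coordinate along the velocity of `X` at `s`, in the frame of velocity and acceleration. -/
def tangentCoord (X : ℝ → Plane) (s : ℝ) (p : Plane) : ℝ :=
  tangentPart X s (p - X s)

/-- The coordinate along the acceleration of `X` at `s`, in the frame of velocity and
acceleration. -/
def heightCoord (X : ℝ → Plane) (s : ℝ) (p : Plane) : ℝ :=
  heightPart X s (p - X s)

/-- A `C^3` curve whose velocity and acceleration are everywhere independent. -/
structure IsNondegenerateOn (X : ℝ → Plane) (I : Set ℝ) : Prop where
  isOpen : IsOpen I
  contDiffOn : ContDiffOn ℝ 3 X I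
  wedge_ne_zero : ∀ s ∈ I, wedge (deriv X s) (deriv (deriv X) s) ≠ 0

theorem frame_decomposition {X : ℝ → Plane} {s : ℝ}
    (hD : wedge (deriv X s) (deriv (deriv X) s) ≠ 0) (p : Plane) :
    p = X s + tangentCoord X s p • deriv X s + heightCoord X s p • deriv (deriv X) s := by
  simp only [tangentCoord, heightCoord, tangentPart, heightPart]
  apply plane_ext <;> simp only [PiLp.add_apply, PiLp.smul_apply, smul_eq_mul] <;> field_simp <;>
    simp only [wedge, PiLp.sub_apply] <;> ring

namespace IsNondegenerateOn

variable {X : ℝ → Plane} {I : Set ℝ} {s : ℝ}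

theorem mem_nhds (hX : IsNondegenerateOn X I) (hs : s ∈ I) : I ∈ 𝓝 s := hX.isOpen.mem_nhds hs

theorem contDiffAt (hX : IsNondegenerateOn X I) (hs : s ∈ I) : ContDiffAt ℝ 3 X s :=
  hX.contDiffOn.contDiffAt (hX.mem_nhds hs)

theorem contDiffAt_deriv (hX : IsNondegenerateOn X I) (hs : s ∈ I) :
    ContDiffAt ℝ 2 (deriv X) s :=
  (hX.contDiffOn.deriv_of_isOpen (m := 2) hX.isOpen (by norm_num)).contDiffAt (hX.mem_nhds hs)

theorem contDiffAt_deriv_deriv (hX : IsNondegenerateOn X I) (hs : s ∈ I) :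
    ContDiffAt ℝ 1 (deriv (deriv X)) s :=
  ((hX.contDiffOn.deriv_of_isOpen (m := 2) hX.isOpen (by norm_num)).deriv_of_isOpen (m := 1)
    hX.isOpen (by norm_num)).contDiffAt (hX.mem_nhds hs)

theorem hasDerivAt (hX : IsNondegenerateOn X I) (hs : s ∈ I) : HasDerivAt X (deriv X s) s :=
  ((hX.contDiffAt hs).differentiableAt (by norm_num)).hasDerivAt

theorem hasDerivAt_deriv (hX : IsNondegenerateOn X I) (hs : s ∈ I) :
    HasDerivAt (deriv X) (deriv (deriv X) s) s :=
  ((hX.contDiffAt_deriv hs).differentiableAt (by norm_num)).hasDerivAt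

theorem hasDerivAt_deriv_deriv (hX : IsNondegenerateOn X I) (hs : s ∈ I) :
    HasDerivAt (deriv (deriv X)) (deriv (deriv (deriv X)) s) s :=
  ((hX.contDiffAt_deriv_deriv hs).differentiableAt (by norm_num)).hasDerivAt

theorem deriv_ne_zero (hX : IsNondegenerateOn X I) (hs : s ∈ I) : deriv X s ≠ 0 := by
  intro h
  have := hX.wedge_ne_zero s hs
  rw [h] at this
  simp [wedge] at this

theorem hasDerivAt_tangentCoord (hX : IsNondegenerateOn X I) (s : ℝ) {u : ℝ} (hu : u ∈ I) :
    HasDerivAt (fun u => tangentCoord X s (X u))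
      (tangentPart X s (deriv X u)) u := by
  refine ((hasDerivAt_wedge ((hX.hasDerivAt hu).sub_const (X s))
    (hasDerivAt_const u (deriv (deriv X) s))).div_const _).congr_deriv ?_
  simp [wedge, tangentPart]

theorem hasDerivAt_heightCoord (hX : IsNondegenerateOn X I) (s : ℝ) {u : ℝ} (hu : u ∈ I) :
    HasDerivAt (fun u => heightCoord X s (X u))
      (heightPart X s (deriv X u)) u := by
  refine ((hasDerivAt_wedge (hasDerivAt_const u (deriv X s))
    ((hX.hasDerivAt hu).sub_const (X s))).div_const _).congr_deriv ?_
  simp [wedge, heightPart]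

theorem osculatingCoords (hX : IsNondegenerateOn X I) (hs : s ∈ I) :
    OsculatingCoords (fun u => tangentCoord X s (X u))
      (fun u => tangentPart X s (deriv X u))
      (fun u => heightCoord X s (X u))
      (fun u => heightPart X s (deriv X u)) s where
  hasDerivAt_A := by
    filter_upwards [hX.mem_nhds hs] with u hu using hX.hasDerivAt_tangentCoord s hu
  hasDerivAt_Y := by
    filter_upwards [hX.mem_nhds hs] with u hu using hX.hasDerivAt_heightCoord s hu
  continuousAt_A' := ((hasDerivAt_wedge (hX.hasDerivAt_deriv hs)
    (hasDerivAt_const s (deriv (deriv X) s))).div_const _).continuousAt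
  hasDerivAt_Y' := by
    refine ((hasDerivAt_wedge (hasDerivAt_const s (deriv X s))
      (hX.hasDerivAt_deriv hs)).div_const _).congr_deriv ?_
    have : wedge 0 (deriv X s) = 0 := by simp [wedge]
    rw [this, zero_add, div_self (hX.wedge_ne_zero s hs)]
  A_self := by simp [tangentCoord, tangentPart, wedge]
  A'_self := div_self (hX.wedge_ne_zero s hs)
  Y_self := by simp [heightCoord, heightPart, wedge]
  Y'_self := by rw [heightPart, wedge_self, zero_div]

end IsNondegenerateOn

/-- Expansion in the orthogonal basis of `n` and its quarter turn. For a unit normal `n` of `v` one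
term drops out, and positive curvature makes velocity and acceleration independent. -/
theorem wedge_mul_norm_sq (v w n : Plane) :
    wedge v w * ‖n‖ ^ 2 = wedge v n * inner ℝ w n - wedge w n * inner ℝ v n := by
  rw [norm_sq_eq, inner_eq, inner_eq]
  simp only [wedge]
  ring

namespace IsStrictlyLocallyConvex

variable {X N : ℝ → Plane} {I : Set ℝ} {s : ℝ}

theorem inner_pos (hX : IsStrictlyLocallyConvex X I N) (hs : s ∈ I) :
    0 < inner ℝ (deriv (deriv X) s) (N s) := by
  have h := hX.curvature_pos s hs
  have hn : 0 < ‖deriv X s‖ ^ 2 := by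
    have := norm_pos_iff.2 (hX.regular s hs)
    positivity
  rwa [curvature, div_pos_iff_of_pos_right hn] at h

theorem wedge_eq (hX : IsStrictlyLocallyConvex X I N) (hs : s ∈ I) :
    wedge (deriv X s) (deriv (deriv X) s) =
      wedge (deriv X s) (N s) * inner ℝ (deriv (deriv X) s) (N s) := by
  have := wedge_mul_norm_sq (deriv X s) (deriv (deriv X) s) (N s)
  rwa [(hX.normal s hs).norm_eq_one, (hX.normal s hs).inner_eq_zero, one_pow, mul_one, mul_zero,
    sub_zero] at this

theorem abs_wedge_normal (hX : IsStrictlyLocallyConvex X I N) (hs : s ∈ I) :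
    |wedge (deriv X s) (N s)| = ‖deriv X s‖ := by
  have h1 := (hX.normal s hs).inner_eq_zero
  have h2 := norm_sq_eq (N s)
  rw [(hX.normal s hs).norm_eq_one] at h2
  rw [inner_eq] at h1
  rw [← abs_of_nonneg (norm_nonneg (deriv X s)), ← sq_eq_sq_iff_abs_eq_abs, norm_sq_eq]
  simp only [wedge]
  linear_combination -(deriv X s 0 * N s 0 + deriv X s 1 * N s 1) * h1 -
    (deriv X s 0 ^ 2 + deriv X s 1 ^ 2) * h2

theorem wedge_normal_ne_zero (hX : IsStrictlyLocallyConvex X I N) (hs : s ∈ I) :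
    wedge (deriv X s) (N s) ≠ 0 := by
  rw [← abs_pos, hX.abs_wedge_normal hs]
  exact norm_pos_iff.2 (hX.regular s hs)

theorem isNondegenerateOn (hX : IsStrictlyLocallyConvex X I N) (hI : IsOpen I) :
    IsNondegenerateOn X I where
  isOpen := hI
  contDiffOn := hX.contDiffOn
  wedge_ne_zero s hs := by
    rw [hX.wedge_eq hs]
    exact mul_ne_zero (hX.wedge_normal_ne_zero hs) (hX.inner_pos hs).ne'

/-- The acceleration has component `κ` along the normal, so height `y` in the affine frame is
Euclidean distance `κ y` from the tangent; hence the substitution `h = κ y` used from here on. -/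
theorem wedge_sub_chordLine (hX : IsStrictlyLocallyConvex X I N) (hs : s ∈ I) (y : ℝ) (p : Plane) :
    wedge (deriv X s) (p - (X s + (inner ℝ (deriv (deriv X) s) (N s) * y) • N s)) =
      wedge (deriv X s) (N s) * inner ℝ (deriv (deriv X) s) (N s) * (heightCoord X s p - y) := by
  have h1 := hX.wedge_eq hs
  have h2 := hX.wedge_normal_ne_zero hs
  have h3 := (hX.inner_pos hs).ne'
  have h4 : wedge (deriv X s) (N s) * inner ℝ (deriv (deriv X) s) (N s) * heightCoord X s p =
      wedge (deriv X s) (p - X s) := by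
    rw [heightCoord, heightPart, h1]
    field_simp
  rw [mul_sub, h4]
  simp only [wedge, PiLp.sub_apply, PiLp.add_apply, PiLp.smul_apply, smul_eq_mul]
  ring

theorem mem_chordLine_iff (hX : IsStrictlyLocallyConvex X I N) (hs : s ∈ I) {y : ℝ} {p : Plane} :
    p ∈ chordLine X N s (inner ℝ (deriv (deriv X) s) (N s) * y) ↔ heightCoord X s p = y := by
  rw [chordLine, mem_lineThrough_iff (hX.regular s hs), hX.wedge_sub_chordLine hs, mul_eq_zero,
    or_iff_right (mul_ne_zero (hX.wedge_normal_ne_zero hs) (hX.inner_pos hs).ne'), sub_eq_zero]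

theorem infDist_chordLine (hX : IsStrictlyLocallyConvex X I N) (hs : s ∈ I) (y : ℝ) (p : Plane) :
    Metric.infDist p (chordLine X N s (inner ℝ (deriv (deriv X) s) (N s) * y)) =
      inner ℝ (deriv (deriv X) s) (N s) * |heightCoord X s p - y| := by
  rw [chordLine, infDist_lineThrough_eq_wedge (hX.regular s hs), hX.wedge_sub_chordLine hs, abs_mul,
    abs_mul, hX.abs_wedge_normal hs, abs_of_pos (hX.inner_pos hs)]
  have : ‖deriv X s‖ ≠ 0 := norm_ne_zero_iff.2 (hX.regular s hs)
  field_simp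

/-- For small heights, the chord is cut off by the two local branches. -/
theorem isChord_iff (hX : IsStrictlyLocallyConvex X I N) (hs : s ∈ I) {Y' α β : ℝ → ℝ} {y₁ y a b : ℝ}
    (B : ChordBranches (fun u => heightCoord X s (X u)) Y' I s y₁ α β) (hy : y ∈ Ioo 0 y₁) :
    IsChord X I N s (inner ℝ (deriv (deriv X) s) (N s) * y) a b ↔ a = α y ∧ b = β y := by
  constructor
  · intro h
    have hl := (hX.mem_chordLine_iff hs).1 h.left_mem
    have hr := (hX.mem_chordLine_iff hs).1 h.right_mem
    have hn : ∀ u ∈ Ioo a b, heightCoord X s (X u) ≠ y := fun u hu =>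
      mt (hX.mem_chordLine_iff hs).2 (h.notMem u hu)
    have := h.left_lt
    have := h.lt_right
    have := B.left_lt y hy
    have := B.lt_right y hy
    -- A branch end strictly inside `(a, b)` would be an earlier meeting with the line. Conversely,
    -- strictly between the branch ends the curve stays below height `y`, so `a` and `b` cannot lie
    -- there.
    have ha : α y ≤ a := by
      by_contra! hlt
      exact hn (α y) ⟨hlt, by linarith⟩ (B.apply_left y hy)
    have hb : b ≤ β y := by
      by_contra! hlt
      exact hn (β y) ⟨by linarith, hlt⟩ (B.apply_right y hy)
    constructor
    · by_contra hne
      exact (B.lt_of_mem y hy a ⟨lt_of_le_of_ne ha (Ne.symm hne), by linarith⟩).ne hl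
    · by_contra hne
      exact (B.lt_of_mem y hy b ⟨by linarith, lt_of_le_of_ne hb hne⟩).ne hr
  · rintro ⟨rfl, rfl⟩
    exact ⟨B.left_lt y hy, B.lt_right y hy, B.subset y hy,
      (hX.mem_chordLine_iff hs).2 (B.apply_left y hy),
      (hX.mem_chordLine_iff hs).2 (B.apply_right y hy), fun u hu hm =>
      (B.lt_of_mem y hy u hu).ne ((hX.mem_chordLine_iff hs).1 hm)⟩

end IsStrictlyLocallyConvex

end

end CentroidParabola

/-! ### The centroid distance in terms of the chord length. -/

namespace CentroidParabola

noncomputable section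

theorem wedge_eq_of_frame {X : ℝ → Plane} {s : ℝ}
    (hD : wedge (deriv X s) (deriv (deriv X) s) ≠ 0) (v w : Plane) :
    wedge v w = wedge (deriv X s) (deriv (deriv X) s) *
      (tangentPart X s v * heightPart X s w - heightPart X s v * tangentPart X s w) := by
  simp only [tangentPart, heightPart]
  field_simp
  simp only [wedge]
  ring

theorem heightCoord_add_smul (X : ℝ → Plane) (s : ℝ) (p v : Plane) (r : ℝ) :
    heightCoord X s (p + r • v) = heightCoord X s p + r * heightPart X s v := by
  simp only [heightCoord, heightPart, wedge, PiLp.sub_apply, PiLp.add_apply, PiLp.smul_apply,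
    smul_eq_mul]
  ring

theorem heightCoord_centroid (X : ℝ → Plane) (s : ℝ) (P Q R : Plane) :
    heightCoord X s (Finset.univ.centroid ℝ ![P, Q, R]) =
      (heightCoord X s P + heightCoord X s Q + heightCoord X s R) / 3 := by
  rw [centroid_triangle]
  simp only [heightCoord, heightPart, wedge, PiLp.sub_apply, PiLp.add_apply, PiLp.smul_apply,
    smul_eq_mul]
  ring

theorem heightPart_sub (X : ℝ → Plane) (s : ℝ) (p q : Plane) :
    heightPart X s (p - q) = heightCoord X s p - heightCoord X s q := by
  simp only [heightCoord, heightPart, wedge, PiLp.sub_apply]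
  ring

theorem tangentPart_sub (X : ℝ → Plane) (s : ℝ) (p q : Plane) :
    tangentPart X s (p - q) = tangentCoord X s p - tangentCoord X s q := by
  simp only [tangentCoord, tangentPart, wedge, PiLp.sub_apply]
  ring

theorem heightCoord_of_mem_tangentLine {X : ℝ → Plane} {s : ℝ} (hT : deriv X s ≠ 0) {p : Plane}
    (hp : p ∈ tangentLine X s) : heightCoord X s p = 0 := by
  rw [tangentLine, mem_lineThrough_iff hT] at hp
  rw [heightCoord, heightPart, hp, zero_div]

/-- The height of the intersection point of the tangent lines at the ends of a chord. -/
theorem heightCoord_tangent_inter {X : ℝ → Plane} {s a b y : ℝ}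
    (hD : wedge (deriv X s) (deriv (deriv X) s) ≠ 0)
    (ha : heightCoord X s (X a) = y) (hb : heightCoord X s (X b) = y)
    (ha' : heightPart X s (deriv X a) ≠ 0) (hb' : heightPart X s (deriv X b) ≠ 0)
    (hab : tangentPart X s (deriv X b) / heightPart X s (deriv X b) -
      tangentPart X s (deriv X a) / heightPart X s (deriv X a) ≠ 0) :
    wedge (deriv X a) (deriv X b) ≠ 0 ∧
    heightCoord X s (X a + (wedge (X b - X a) (deriv X b) / wedge (deriv X a) (deriv X b)) •
      deriv X a) = y - (tangentCoord X s (X b) - tangentCoord X s (X a)) /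
        (tangentPart X s (deriv X b) / heightPart X s (deriv X b) -
          tangentPart X s (deriv X a) / heightPart X s (deriv X a)) := by
  -- The chord is purely tangential because its ends have equal height. Along the two tangents `a`
  -- is an affine function of `y`, and their gap, `l` at height `y`, closes after a descent of `l`
  -- divided by the difference of the slopes.
  rw [heightCoord_add_smul, ha, wedge_eq_of_frame hD (X b - X a), heightPart_sub, ha, hb, sub_self,
    zero_mul, sub_zero, tangentPart_sub, wedge_eq_of_frame hD (deriv X a) (deriv X b)]
  generalize tangentPart X s (deriv X b) = p at *
  generalize tangentPart X s (deriv X a) = q at *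
  generalize heightPart X s (deriv X b) = g at *
  generalize heightPart X s (deriv X a) = f at *
  generalize tangentCoord X s (X b) - tangentCoord X s (X a) = l at *
  generalize wedge (deriv X s) (deriv (deriv X) s) = D at *
  have e : p / g - q / f = -((q * g - f * p) / (g * f)) := by field_simp; ring
  rw [e] at hab ⊢
  have h0 : q * g - f * p ≠ 0 := by
    intro h
    simp [h] at hab
  refine ⟨mul_ne_zero hD h0, ?_⟩
  field_simp
  ring

namespace IsStrictlyLocallyConvex

variable {X N : ℝ → Plane} {I : Set ℝ} {s : ℝ}

/-- The vertices have heights `y - L/L'`, `0` and `0`. The centroid is therefore `y - (y - L/L')/3 =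
2y/3 + L/(3L')` below the chord line, and `κ` turns this into a distance. -/
theorem isCentroidDist_iff (hX : IsStrictlyLocallyConvex X I N) (hI : IsOpen I) (hs : s ∈ I)
    {α β : ℝ → ℝ} {y₁ : ℝ}
    (B : ChordBranches (fun u => heightCoord X s (X u)) (fun u => heightPart X s (deriv X u))
      I s y₁ α β) :
    ∀ᶠ y in 𝓝[>] 0, ∀ k,
      IsCentroidDist X I N s (inner ℝ (deriv (deriv X) s) (N s) * y) k ↔
        k = inner ℝ (deriv (deriv X) s) (N s) * (2 / 3 * y +
          chordLength (fun u => tangentCoord X s (X u)) α β y /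
            chordRate (fun u => tangentPart X s (deriv X u))
              (fun u => heightPart X s (deriv X u)) α β y / 3) := by
  have hX' := hX.isNondegenerateOn hI
  have hO := hX'.osculatingCoords hs
  have hD := hX'.wedge_ne_zero s hs
  have hT := hX.regular s hs
  filter_upwards [B.eventually_mem, hO.eventually_chordRate_pos B, hO.eventually_chordLength_pos B]
    with y hy hrate hlen k
  have ha' := B.deriv_left_neg y hy
  have hb' := B.deriv_right_pos y hy
  obtain ⟨hab, hQ⟩ := heightCoord_tangent_inter hD (B.apply_left y hy) (B.apply_right y hy) ha'.ne
    hb'.ne' hrate.ne'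
  have hsa : wedge (deriv X (α y)) (deriv X s) ≠ 0 := by
    intro h
    have : wedge (deriv X s) (deriv X (α y)) = 0 := by
      simp only [wedge] at h ⊢; linarith
    simp [heightPart, this] at ha'
  have hsb : wedge (deriv X (β y)) (deriv X s) ≠ 0 := by
    intro h
    have : wedge (deriv X s) (deriv X (β y)) = 0 := by
      simp only [wedge] at h ⊢; linarith
    simp [heightPart, this] at hb'
  have iQ := inter_lineThrough_eq_singleton (p := X (α y)) (q := X (β y)) hab
  have iA := inter_lineThrough_eq_singleton (p := X (α y)) (q := X s) hsa
  have iB := inter_lineThrough_eq_singleton (p := X (β y)) (q := X s) hsb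
  have hdist : ∀ Q A₁ B₁ : Plane,
      (tangentLine X (α y) : Set Plane) ∩ tangentLine X (β y) = {Q} →
      (tangentLine X (α y) : Set Plane) ∩ tangentLine X s = {A₁} →
      (tangentLine X (β y) : Set Plane) ∩ tangentLine X s = {B₁} →
      Metric.infDist (Finset.univ.centroid ℝ ![Q, A₁, B₁])
        (chordLine X N s (inner ℝ (deriv (deriv X) s) (N s) * y)) =
      inner ℝ (deriv (deriv X) s) (N s) * (2 / 3 * y +
          chordLength (fun u => tangentCoord X s (X u)) α β y /
            chordRate (fun u => tangentPart X s (deriv X u))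
              (fun u => heightPart X s (deriv X u)) α β y / 3) := by
    intro Q A₁ B₁ h1 h2 h3
    have hA : heightCoord X s A₁ = 0 :=
      heightCoord_of_mem_tangentLine hT (h2.ge (mem_singleton A₁)).2
    have hB : heightCoord X s B₁ = 0 :=
      heightCoord_of_mem_tangentLine hT (h3.ge (mem_singleton B₁)).2
    have hQ' := singleton_injective (h1.symm.trans iQ)
    rw [hX.infDist_chordLine hs, heightCoord_centroid, hA, hB, hQ', hQ]
    congr 1
    rw [chordLength, chordRate] at *
    have hpos := div_pos hlen hrate
    rw [abs_of_neg]
    · ring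
    · linarith [hy.1]
  constructor
  · rintro ⟨a, b, Q, A₁, B₁, hc, h1, h2, h3, rfl⟩
    obtain ⟨rfl, rfl⟩ := (hX.isChord_iff hs B hy).1 hc
    exact hdist Q A₁ B₁ h1 h2 h3
  · rintro rfl
    exact ⟨α y, β y, _, _, _, (hX.isChord_iff hs B hy).2 ⟨rfl, rfl⟩, iQ, iA, iB,
      (hdist _ _ _ iQ iA iB).symm⟩

end IsStrictlyLocallyConvex

theorem eventually_nhdsGT_zero_mul_iff {κ : ℝ} (hκ : 0 < κ) {p : ℝ → Prop} :
    (∀ᶠ y in 𝓝[>] (0 : ℝ), p (κ * y)) ↔ ∀ᶠ h in 𝓝[>] (0 : ℝ), p h := by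
  have key : ∀ {c : ℝ}, 0 < c → Tendsto (fun y : ℝ => c * y) (𝓝[>] 0) (𝓝[>] 0) := by
    intro c hc
    refine tendsto_nhdsWithin_of_tendsto_nhds_of_eventually_within _ ?_ ?_
    · have : ContinuousAt (fun y : ℝ => c * y) 0 := by fun_prop
      have := this.tendsto
      rw [mul_zero] at this
      exact this.mono_left nhdsWithin_le_nhds
    · filter_upwards [self_mem_nhdsWithin] with y hy
      exact mul_pos hc hy
  constructor
  · intro h
    filter_upwards [(key (inv_pos.2 hκ)).eventually h] with y hy
    rwa [mul_inv_cancel_left₀ hκ.ne'] at hy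
  · intro h
    exact (key hκ).eventually h

namespace IsStrictlyLocallyConvex

variable {X N : ℝ → Plane} {I : Set ℝ} {s : ℝ}

/-- After division by `κ`, the equation `2y/3 + L/(3L') = 4y/3` is `L = 2yL'`. -/
theorem eventually_isCentroidDist_iff (hX : IsStrictlyLocallyConvex X I N) (hI : IsOpen I)
    (hs : s ∈ I) {α β : ℝ → ℝ} {y₁ : ℝ}
    (B : ChordBranches (fun u => heightCoord X s (X u)) (fun u => heightPart X s (deriv X u))
      I s y₁ α β) :
    (∀ᶠ h in 𝓝[>] 0, IsCentroidDist X I N s h (4 / 3 * h)) ↔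
      ∀ᶠ y in 𝓝[>] 0, chordLength (fun u => tangentCoord X s (X u)) α β y ^ 2 = 8 * y := by
  have hX' := hX.isNondegenerateOn hI
  have hO := hX'.osculatingCoords hs
  have hκ := hX.inner_pos hs
  rw [← eventually_nhdsGT_zero_mul_iff hκ, hO.eventually_chordLength_sq_iff B]
  refine eventually_congr ?_
  filter_upwards [hX.isCentroidDist_iff hI hs B, hO.eventually_chordRate_pos B] with y hy hpos
  rw [hy, ← mul_assoc, mul_comm (4 / 3 : ℝ), mul_assoc, mul_right_inj' hκ.ne', ← div_eq_iff hpos.ne']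
  constructor
  · intro h; linarith
  · intro h; linarith

/-- If the centroid distance is a power function of `h`, it is `4 / 3 * h`. -/
theorem eventually_isCentroidDist_of_rpow (hX : IsStrictlyLocallyConvex X I N) (hI : IsOpen I)
    (hs : s ∈ I) {c m : ℝ}
    (hc : ∀ᶠ h in 𝓝[>] (0 : ℝ), IsCentroidDist X I N s h (c * h ^ m)) :
    ∀ᶠ h in 𝓝[>] (0 : ℝ), IsCentroidDist X I N s h (4 / 3 * h) := by
  have hX' := hX.isNondegenerateOn hI
  have hO := hX'.osculatingCoords hs
  have hκ := hX.inner_pos hs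
  obtain ⟨y₁, α, β, B⟩ := hO.exists_chordBranches (hX'.mem_nhds hs)
  set κ := inner ℝ (deriv (deriv X) s) (N s) with hκdef
  -- This is the quotient `k/h` at `h = κ y`; its limit is `2/3 + 2/3`, because `L/(L'y) → 2`.
  have hlim : Tendsto (fun y => c * (κ * y) ^ (m - 1)) (𝓝[>] 0) (𝓝 (4 / 3)) := by
    have h1 : Tendsto (fun y => 2 / 3 + chordLength (fun u => tangentCoord X s (X u)) α β y /
            chordRate (fun u => tangentPart X s (deriv X u))
              (fun u => heightPart X s (deriv X u)) α β y / y / 3) (𝓝[>] 0) (𝓝 (4 / 3)) := by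
      have := ((hO.tendsto_chordLength_div_chordRate B).div_const 3).const_add (2 / 3)
      norm_num at this
      exact this
    refine h1.congr' ?_
    filter_upwards [hX.isCentroidDist_iff hI hs B,
      (eventually_nhdsGT_zero_mul_iff hκ).2 hc, self_mem_nhdsWithin] with y h2 h3 hy
    have hy0 : (0 : ℝ) < y := hy
    rw [h2, ← hκdef] at h3
    rw [Real.rpow_sub_one (mul_pos hκ hy0).ne', ← mul_div_assoc, h3]
    field_simp
  have hlim' : Tendsto (fun h => c * h ^ (m - 1)) (𝓝[>] 0) (𝓝 (4 / 3)) := by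
    intro V hV
    exact (eventually_nhdsGT_zero_mul_iff hκ (p := fun h => c * h ^ (m - 1) ∈ V)).1 (hlim hV)
  have hzero : ∀ {r : ℝ}, 0 < r → Tendsto (fun h : ℝ => h ^ r) (𝓝[>] 0) (𝓝 0) := by
    intro r hr
    have := (Real.continuousAt_rpow_const 0 r (Or.inr hr.le)).tendsto
    rw [Real.zero_rpow hr.ne'] at this
    exact this.mono_left nhdsWithin_le_nhds
  have hm : m = 1 := by
    -- For `m < 1` a finite limit forces `c = 0`, and for `m > 1` the limit is `0`; neither is
    -- compatible with `4/3`.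
    rcases lt_trichotomy m 1 with h | h | h
    · exfalso
      have h1 := hlim'.mul (hzero (sub_pos.2 h))
      rw [mul_zero] at h1
      have h2 : Tendsto (fun _ : ℝ => c) (𝓝[>] (0 : ℝ)) (𝓝 0) := by
        refine h1.congr' ?_
        filter_upwards [self_mem_nhdsWithin] with y hy
        rw [mul_assoc, ← Real.rpow_add hy]
        simp
      have hc0 := tendsto_nhds_unique tendsto_const_nhds h2
      rw [hc0] at hlim'
      simp only [zero_mul] at hlim'
      have := tendsto_nhds_unique tendsto_const_nhds hlim'
      norm_num at this
    · exact h
    · exfalso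
      have h1 := (hzero (sub_pos.2 h)).const_mul c
      rw [mul_zero] at h1
      have := tendsto_nhds_unique h1 hlim'
      norm_num at this
  subst hm
  simp only [sub_self, Real.rpow_zero, mul_one] at hlim'
  have hc0 := tendsto_nhds_unique tendsto_const_nhds hlim'
  rw [hc0] at hc
  simpa using hc

end IsStrictlyLocallyConvex

end

end CentroidParabola

/-! ### Parabolas in normal form at a point of the curve. -/

namespace CentroidParabola

noncomputable section

namespace OsculatingCoords

variable {A A' Y Y' : ℝ → ℝ} {U : Set ℝ} {s y₁ ρ : ℝ} {α β : ℝ → ℝ}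

theorem tendsto_A (h : OsculatingCoords A A' Y Y' s) : Tendsto A (𝓝 s) (𝓝 0) := by
  simpa [h.A_self] using h.hasDerivAt_A.self_of_nhds.continuousAt.tendsto

theorem tendsto_Y (h : OsculatingCoords A A' Y Y' s) : Tendsto Y (𝓝 s) (𝓝 0) := by
  simpa [h.Y_self] using h.hasDerivAt_Y.self_of_nhds.continuousAt.tendsto

theorem tendsto_Y_left (h : OsculatingCoords A A' Y Y' s) (B : ChordBranches Y Y' U s y₁ α β) :
    Tendsto Y (𝓝[<] s) (𝓝[>] 0) :=
  tendsto_nhdsWithin_of_tendsto_nhds_of_eventually_within _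
    (h.tendsto_Y.mono_left nhdsWithin_le_nhds) (B.left_inv.mono fun _ hu => hu.1.1)

theorem tendsto_Y_right (h : OsculatingCoords A A' Y Y' s) (B : ChordBranches Y Y' U s y₁ α β) :
    Tendsto Y (𝓝[>] s) (𝓝[>] 0) :=
  tendsto_nhdsWithin_of_tendsto_nhds_of_eventually_within _
    (h.tendsto_Y.mono_left nhdsWithin_le_nhds) (B.right_inv.mono fun _ hu => hu.1.1)

theorem tendsto_mul_div_sqrt_zero (ρ : ℝ) : Tendsto (fun y : ℝ => ρ * y / √y) (𝓝[>] 0) (𝓝 0) := by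
  have h1 : ContinuousAt (fun y : ℝ => ρ * √y) 0 := by fun_prop
  have h2 := h1.tendsto
  rw [Real.sqrt_zero, mul_zero] at h2
  refine (h2.mono_left nhdsWithin_le_nhds).congr fun y => ?_
  rw [mul_div_assoc, Real.div_sqrt]

/-- The sign of the root is decided by the asymptotics: `A (α y) / √y → -√2`, while `ρ y / √y → 0`.
-/
theorem eventually_left_iff (h : OsculatingCoords A A' Y Y' s)
    (B : ChordBranches Y Y' U s y₁ α β) :
    (∀ᶠ u in 𝓝[<] s, (A u + ρ * Y u) ^ 2 = 2 * Y u) ↔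
      ∀ᶠ y in 𝓝[>] 0, A (α y) + ρ * y = -√(2 * y) := by
  constructor
  · intro hp
    have h1 := (tendsto_comp_div_sqrt h.tendsto_A_div B.tendsto_left_ne
      (h.tendsto_left_sub_div_sqrt B)).add (tendsto_mul_div_sqrt_zero ρ)
    have h2 : -√2 + 0 < 0 := by simp
    filter_upwards [B.tendsto_left'.eventually hp, h1.eventually_lt_const h2, B.eventually_mem]
      with y hy hneg hy1
    rw [B.apply_left y hy1] at hy
    rw [← add_div] at hneg
    have hneg' : A (α y) + ρ * y < 0 := by
      by_contra! hc
      exact absurd (div_nonneg hc (Real.sqrt_nonneg y)) (not_le.2 hneg)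
    rw [← hy, Real.sqrt_sq_eq_abs, abs_of_neg hneg', neg_neg]
  · intro hp
    filter_upwards [(h.tendsto_Y_left B).eventually hp, B.left_inv] with u hu hu'
    rw [hu'.2] at hu
    rw [hu, neg_sq, Real.sq_sqrt (by linarith [hu'.1.1])]

theorem eventually_right_iff (h : OsculatingCoords A A' Y Y' s)
    (B : ChordBranches Y Y' U s y₁ α β) :
    (∀ᶠ u in 𝓝[>] s, (A u + ρ * Y u) ^ 2 = 2 * Y u) ↔
      ∀ᶠ y in 𝓝[>] 0, A (β y) + ρ * y = √(2 * y) := by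
  constructor
  · intro hp
    have h1 := (tendsto_comp_div_sqrt h.tendsto_A_div B.tendsto_right_ne
      (h.tendsto_right_sub_div_sqrt B)).add (tendsto_mul_div_sqrt_zero ρ)
    have h2 : 0 < √2 + 0 := by simp
    filter_upwards [B.tendsto_right'.eventually hp, h1.eventually_const_lt h2, B.eventually_mem]
      with y hy hpos hy1
    rw [B.apply_right y hy1] at hy
    rw [← add_div] at hpos
    have hpos' : 0 < A (β y) + ρ * y := by
      by_contra! hc
      exact absurd (div_nonpos_of_nonpos_of_nonneg hc (Real.sqrt_nonneg y)) (not_le.2 hpos)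
    rw [← hy, Real.sqrt_sq_eq_abs, abs_of_pos hpos']
  · intro hp
    filter_upwards [(h.tendsto_Y_right B).eventually hp, B.right_inv] with u hu hu'
    rw [hu'.2] at hu
    rw [hu, Real.sq_sqrt (by linarith [hu'.1.1])]

theorem eventually_chordLength_sq_iff_eq_sqrt (h : OsculatingCoords A A' Y Y' s)
    (B : ChordBranches Y Y' U s y₁ α β) :
    (∀ᶠ y in 𝓝[>] 0, chordLength A α β y ^ 2 = 8 * y) ↔
      ∀ᶠ y in 𝓝[>] 0, chordLength A α β y = 2 * √(2 * y) := by
  refine eventually_congr ?_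
  filter_upwards [h.eventually_chordLength_pos B, self_mem_nhdsWithin] with y hpos hy
  have hy0 : (0 : ℝ) < y := hy
  have e : 8 * y = (2 * √(2 * y)) ^ 2 := by
    rw [mul_pow, Real.sq_sqrt (by positivity)]; ring
  rw [e, sq_eq_sq₀ hpos.le (by positivity)]

/-- Given the chord lengths, an arc on one side of the point that lies on the parabola
`(a + ρ y) ^ 2 = 2 y` continues along this parabola on the other side. -/
theorem eventually_of_left_or_right (h : OsculatingCoords A A' Y Y' s)
    (B : ChordBranches Y Y' U s y₁ α β)
    (hc : ∀ᶠ y in 𝓝[>] 0, chordLength A α β y ^ 2 = 8 * y)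
    (hp : (∀ᶠ u in 𝓝[<] s, (A u + ρ * Y u) ^ 2 = 2 * Y u) ∨
      ∀ᶠ u in 𝓝[>] s, (A u + ρ * Y u) ^ 2 = 2 * Y u) :
    ∀ᶠ u in 𝓝 s, (A u + ρ * Y u) ^ 2 = 2 * Y u := by
  rw [h.eventually_chordLength_sq_iff_eq_sqrt B] at hc
  -- The roots `±√(2y)` differ by exactly the chord length, so either branch determines the other.
  have hboth : (∀ᶠ u in 𝓝[<] s, (A u + ρ * Y u) ^ 2 = 2 * Y u) ∧
      ∀ᶠ u in 𝓝[>] s, (A u + ρ * Y u) ^ 2 = 2 * Y u := by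
    rcases hp with hp | hp
    · refine ⟨hp, (h.eventually_right_iff B).2 ?_⟩
      filter_upwards [(h.eventually_left_iff B).1 hp, hc] with y h1 h2
      rw [chordLength] at h2
      linarith
    · refine ⟨(h.eventually_left_iff B).2 ?_, hp⟩
      filter_upwards [(h.eventually_right_iff B).1 hp, hc] with y h1 h2
      rw [chordLength] at h2
      linarith
  rw [← nhdsNE_sup_pure s, eventually_sup, ← nhdsLT_sup_nhdsGT, eventually_sup]
  refine ⟨hboth, ?_⟩
  simp [h.A_self, h.Y_self]

theorem eventually_chordLength_sq_of_eventually (h : OsculatingCoords A A' Y Y' s)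
    (B : ChordBranches Y Y' U s y₁ α β)
    (hp : ∀ᶠ u in 𝓝 s, (A u + ρ * Y u) ^ 2 = 2 * Y u) :
    ∀ᶠ y in 𝓝[>] 0, chordLength A α β y ^ 2 = 8 * y := by
  rw [h.eventually_chordLength_sq_iff_eq_sqrt B]
  filter_upwards [(h.eventually_left_iff B).1 (hp.filter_mono nhdsWithin_le_nhds),
    (h.eventually_right_iff B).1 (hp.filter_mono nhdsWithin_le_nhds)] with y h1 h2
  rw [chordLength]
  linarith

/-- The normal form of the equation of a parabola along which the curve runs. -/
theorem coeff_of_eventually (h : OsculatingCoords A A' Y Y' s) {l : Filter ℝ} [l.NeBot]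
    (hl : l ≤ 𝓝[≠] s) {e₀ e₁ e₂ f₀ f₁ f₂ : ℝ} (hdet : e₁ * f₂ - e₂ * f₁ ≠ 0)
    (hp : ∀ᶠ u in l, (e₀ + e₁ * A u + e₂ * Y u) ^ 2 = f₀ + f₁ * A u + f₂ * Y u) :
    f₀ = e₀ ^ 2 ∧ f₁ = 2 * e₀ * e₁ ∧ f₂ = 2 * e₀ * e₂ + 2 * e₁ ^ 2 ∧ e₁ ≠ 0 := by
  have hln : l ≤ 𝓝 s := hl.trans nhdsWithin_le_nhds
  have hA := h.tendsto_A.mono_left hln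
  have hY := h.tendsto_Y.mono_left hln
  have hA1 := h.tendsto_A_div.mono_left hl
  have hY2 := h.tendsto_Y_div.mono_left hl
  have hne : ∀ᶠ u in l, u - s ≠ 0 := by
    filter_upwards [hl self_mem_nhdsWithin] with u hu using sub_ne_zero.2 hu
  have hu0 : Tendsto (fun u => u - s) l (𝓝 0) := by
    have : ContinuousAt (fun u : ℝ => u - s) s := by fun_prop
    have := this.tendsto
    rw [sub_self] at this
    exact this.mono_left hln
  have hY1 : Tendsto (fun u => Y u / (u - s)) l (𝓝 0) := by
    have := hY2.mul hu0
    rw [mul_zero] at this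
    refine this.congr' ?_
    filter_upwards [hne] with u hu
    field_simp
  -- The three relations compare the terms of order `0`, `1` and `2` in `u - s`; each comparison
  -- uses the preceding ones.
  have h0 : f₀ = e₀ ^ 2 := by
    have h1 := (((hA.const_mul e₁).const_add e₀).add (hY.const_mul e₂)).pow 2
    have h2 := ((hA.const_mul f₁).const_add f₀).add (hY.const_mul f₂)
    have := tendsto_nhds_unique (h1.congr' hp) h2
    simpa using this.symm
  have h1 : f₁ = 2 * e₀ * e₁ := by
    have t1 := ((hA1.const_mul (2 * e₀ * e₁ - f₁)).add (hY1.const_mul (2 * e₀ * e₂ - f₂))).add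
      (((hA1.const_mul e₁).add (hY1.const_mul e₂)).mul ((hA.const_mul e₁).add (hY.const_mul e₂)))
    have t2 : Tendsto (fun _ : ℝ => (0 : ℝ)) l (𝓝 0) := tendsto_const_nhds
    have := tendsto_nhds_unique (t1.congr' ?_) t2
    · linear_combination -this
    · filter_upwards [hp, hne] with u hu hu'
      field_simp
      linear_combination hu + h0
  have h2 : 2 * e₁ ^ 2 = f₂ - 2 * e₀ * e₂ := by
    have t1 := (((hA1.const_mul e₁).add (hY1.const_mul e₂)).pow 2).sub
      (hY2.const_mul (f₂ - 2 * e₀ * e₂))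
    have t2 : Tendsto (fun _ : ℝ => (0 : ℝ)) l (𝓝 0) := tendsto_const_nhds
    have := tendsto_nhds_unique (t1.congr' ?_) t2
    · linear_combination 2 * this
    · filter_upwards [hp, hne] with u hu hu'
      field_simp
      linear_combination hu + h0 + A u * h1
  refine ⟨h0, h1, by linarith, ?_⟩
  rintro rfl
  apply hdet
  rw [h1]
  ring

end OsculatingCoords

namespace IsNondegenerateOn

variable {X : ℝ → Plane} {I : Set ℝ} {s : ℝ}

theorem exists_normal_form (hX : IsNondegenerateOn X I) (hs : s ∈ I) {S : Set Plane}
    (hS : IsParabola S) {l : Filter ℝ} [l.NeBot] (hl : l ≤ 𝓝[≠] s) (hp : ∀ᶠ u in l, X u ∈ S) :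
    ∃ ρ : ℝ, ∀ p, p ∈ S ↔
      (tangentCoord X s p + ρ * heightCoord X s p) ^ 2 = 2 * heightCoord X s p := by
  obtain ⟨c₁, c₂, c₀, d₁, d₂, d₀, hcd, rfl⟩ := (isParabola_iff S).1 hS
  have hD := hX.wedge_ne_zero s hs
  have hO := hX.osculatingCoords hs
  have hlin : ∀ (k₁ k₂ k₀ : ℝ) (p : Plane), k₁ * p 0 + k₂ * p 1 + k₀ =
      (k₁ * X s 0 + k₂ * X s 1 + k₀) + (k₁ * deriv X s 0 + k₂ * deriv X s 1) * tangentCoord X s p +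
        (k₁ * deriv (deriv X) s 0 + k₂ * deriv (deriv X) s 1) * heightCoord X s p := by
    intro k₁ k₂ k₀ p
    have hp := frame_decomposition hD p
    have hp0 := congrArg (fun v : Plane => v 0) hp
    have hp1 := congrArg (fun v : Plane => v 1) hp
    simp only [PiLp.add_apply, PiLp.smul_apply, smul_eq_mul] at hp0 hp1
    linear_combination k₁ * hp0 + k₂ * hp1
  have hp' := hp.mono fun u hu => by
    rw [mem_ofPred_eq, hlin c₁ c₂ c₀ (X u), hlin d₁ d₂ d₀ (X u)] at hu
    exact hu
  have hdet : (c₁ * deriv X s 0 + c₂ * deriv X s 1) *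
      (d₁ * deriv (deriv X) s 0 + d₂ * deriv (deriv X) s 1) -
      (c₁ * deriv (deriv X) s 0 + c₂ * deriv (deriv X) s 1) *
      (d₁ * deriv X s 0 + d₂ * deriv X s 1) ≠ 0 := by
    have := mul_ne_zero hcd hD
    convert this using 1
    simp only [wedge]
    ring
  obtain ⟨h0, h1, h2, h3⟩ := hO.coeff_of_eventually hl hdet hp'
  -- By the coefficient relations the equation reduces to `(e₁ a + e₂ y)² = 2 e₁² y`, hence `ρ = e₂
  -- / e₁`.
  refine ⟨(c₁ * deriv (deriv X) s 0 + c₂ * deriv (deriv X) s 1) /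
    (c₁ * deriv X s 0 + c₂ * deriv X s 1), fun p => ?_⟩
  rw [mem_ofPred_eq, hlin c₁ c₂ c₀ p, hlin d₁ d₂ d₀ p, h0, h1, h2]
  generalize c₁ * deriv X s 0 + c₂ * deriv X s 1 = e₁ at *
  generalize c₁ * deriv (deriv X) s 0 + c₂ * deriv (deriv X) s 1 = e₂ at *
  generalize c₁ * X s 0 + c₂ * X s 1 + c₀ = e₀ at *
  rw [← mul_right_inj' (pow_ne_zero 2 h3), ← mul_pow]
  field_simp
  constructor
  · intro h; linear_combination h
  · intro h; linear_combination h

theorem isParabola_of_normal_form (hX : IsNondegenerateOn X I) (hs : s ∈ I) (ρ : ℝ) :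
    IsParabola {p | (tangentCoord X s p + ρ * heightCoord X s p) ^ 2 = 2 * heightCoord X s p} := by
  have hD := hX.wedge_ne_zero s hs
  rw [isParabola_iff]
  set D := wedge (deriv X s) (deriv (deriv X) s) with hDdef
  set T := deriv X s with hT
  set T₂ := deriv (deriv X) s with hT₂
  refine ⟨(T₂ 1 - ρ * T 1) / D, (-T₂ 0 + ρ * T 0) / D,
    (-(X s 0 * (T₂ 1 - ρ * T 1)) - X s 1 * (-T₂ 0 + ρ * T 0)) / D, -2 * T 1 / D, 2 * T 0 / D,
    2 * (T 1 * X s 0 - T 0 * X s 1) / D, ?_, ?_⟩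
  · have : (T₂ 1 - ρ * T 1) / D * (2 * T 0 / D) - (-T₂ 0 + ρ * T 0) / D * (-2 * T 1 / D) =
        2 / D := by
      field_simp
      rw [hDdef, wedge]
      ring
    rw [this]
    positivity
  · ext p
    rw [mem_ofPred_eq, mem_ofPred_eq]
    have e1 : tangentCoord X s p + ρ * heightCoord X s p = (T₂ 1 - ρ * T 1) / D * p 0 +
        (-T₂ 0 + ρ * T 0) / D * p 1 +
        (-(X s 0 * (T₂ 1 - ρ * T 1)) - X s 1 * (-T₂ 0 + ρ * T 0)) / D := by
      rw [tangentCoord, heightCoord, tangentPart, heightPart, ← hT, ← hT₂, ← hDdef]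
      simp only [wedge, PiLp.sub_apply]
      ring
    have e2 : 2 * heightCoord X s p = -2 * T 1 / D * p 0 + 2 * T 0 / D * p 1 +
        2 * (T 1 * X s 0 - T 0 * X s 1) / D := by
      rw [heightCoord, heightPart, ← hT, ← hT₂, ← hDdef]
      simp only [wedge, PiLp.sub_apply]
      ring
    rw [e1, e2]

end IsNondegenerateOn

end

end CentroidParabola

/-! ### Moving the point of tangency at fixed height. -/

namespace CentroidParabola

noncomputable section

theorem contDiffAt_wedge {E : Type*} [NormedAddCommGroup E] [NormedSpace ℝ E] {f g : E → Plane}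
    {x : E} {n : WithTop ℕ∞} (hf : ContDiffAt ℝ n f x) (hg : ContDiffAt ℝ n g x) :
    ContDiffAt ℝ n (fun z => wedge (f z) (g z)) x := by
  have hc : ∀ {f : E → Plane}, ContDiffAt ℝ n f x → ∀ i : Fin 2,
      ContDiffAt ℝ n (fun z => f z i) x := fun hf i =>
    (EuclideanSpace.proj (𝕜 := ℝ) i).contDiff.contDiffAt.comp x hf
  exact ((hc hf 0).mul (hc hg 1)).sub ((hc hf 1).mul (hc hg 0))

namespace IsNondegenerateOn

variable {X : ℝ → Plane} {I : Set ℝ} {s u : ℝ}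

theorem contDiffAt_heightCoord (hX : IsNondegenerateOn X I) (hs : s ∈ I) (hu : u ∈ I) :
    ContDiffAt ℝ 1 (fun z : ℝ × ℝ => heightCoord X z.1 (X z.2)) (s, u) := by
  have h1 : ContDiffAt ℝ 1 (fun z : ℝ × ℝ => X z.1) (s, u) :=
    ((hX.contDiffAt hs).of_le (by norm_num)).comp (s, u) contDiffAt_fst
  have h2 : ContDiffAt ℝ 1 (fun z : ℝ × ℝ => X z.2) (s, u) :=
    ((hX.contDiffAt hu).of_le (by norm_num)).comp (s, u) contDiffAt_snd
  have h3 : ContDiffAt ℝ 1 (fun z : ℝ × ℝ => deriv X z.1) (s, u) :=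
    ((hX.contDiffAt_deriv hs).of_le (by norm_num)).comp (s, u) contDiffAt_fst
  have h4 : ContDiffAt ℝ 1 (fun z : ℝ × ℝ => deriv (deriv X) z.1) (s, u) :=
    (hX.contDiffAt_deriv_deriv hs).comp (s, u) contDiffAt_fst
  exact (contDiffAt_wedge h3 (h2.sub h1)).div (contDiffAt_wedge h3 h4) (hX.wedge_ne_zero s hs)

/-- The parameter of the point at a fixed height above a moving tangent line is a differentiable
function of the point of tangency. -/
theorem exists_level_curve (hX : IsNondegenerateOn X I) (hs : s ∈ I) (hu : u ∈ I)
    (hne : heightPart X s (deriv X u) ≠ 0) :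
    ∃ (ψ : ℝ → ℝ) (ψ' : ℝ), ψ s = u ∧ HasDerivAt ψ ψ' s ∧
      ∀ᶠ t in 𝓝 s, heightCoord X t (X (ψ t)) = heightCoord X s (X u) := by
  have hf := (hX.contDiffAt_heightCoord hs hu).hasStrictFDerivAt (by norm_num)
  set f' := fderiv ℝ (fun z : ℝ × ℝ => heightCoord X z.1 (X z.2)) (s, u)
  have hpartial : f' (0, 1) = heightPart X s (deriv X u) := by
    have h1 : HasDerivAt (fun v : ℝ => (s, v)) ((0 : ℝ), (1 : ℝ)) u :=
      (hasDerivAt_const u s).prodMk (hasDerivAt_id' u)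
    have h2 := hf.hasFDerivAt.comp_hasDerivAt u h1
    exact h2.unique (hX.hasDerivAt_heightCoord s hu)
  -- The implicit function theorem applies because the partial derivative in the second parameter is
  -- the nonzero number `heightPart X s (deriv X u)`.
  have hinv : (f' ∘L .inr ℝ ℝ ℝ).IsInvertible := by
    refine ContinuousLinearMap.IsInvertible.of_inverse
      (g := (heightPart X s (deriv X u))⁻¹ • ContinuousLinearMap.id ℝ ℝ) ?_ ?_
    · ext
      simp [hpartial, hne]
    · ext
      simp [hpartial, hne]
  have hder := (hf.hasStrictFDerivAt_implicitFunctionOfProdDomain hinv).hasFDerivAt.hasDerivAt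
  refine ⟨hf.implicitFunctionOfProdDomain hinv, _, ?_, hder, ?_⟩
  · exact tendsto_nhds_unique hder.continuousAt.tendsto (hf.tendsto_implicitFunctionOfProdDomain hinv)
  · exact hf.eventually_apply_implicitFunctionOfProdDomain hinv

theorem hasDerivAt_tangentCoord_comp (hX : IsNondegenerateOn X I) (hs : s ∈ I) (hu : u ∈ I)
    {ψ : ℝ → ℝ} {ψ' : ℝ} (hψs : ψ s = u) (hψ : HasDerivAt ψ ψ' s) :
    ∃ w, HasDerivAt (fun t => tangentCoord X t (X (ψ t))) w s := by
  subst hψs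
  have h1 : HasDerivAt (fun t => X (ψ t)) (ψ' • deriv X (ψ s)) s := (hX.hasDerivAt hu).scomp s hψ
  exact ⟨_, (hasDerivAt_wedge (h1.sub (hX.hasDerivAt hs)) (hX.hasDerivAt_deriv_deriv hs)).fun_div
    (hasDerivAt_wedge (hX.hasDerivAt_deriv hs) (hX.hasDerivAt_deriv_deriv hs))
    (hX.wedge_ne_zero s hs)⟩

/-- The derivative of the tangential coordinate along a curve of constant height. -/
theorem exists_level_curve_tangentCoord (hX : IsNondegenerateOn X I) (hs : s ∈ I) (hu : u ∈ I)
    (hne : heightPart X s (deriv X u) ≠ 0) :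
    ∃ (ψ : ℝ → ℝ) (w : ℝ), ψ s = u ∧ ContinuousAt ψ s ∧
      (∀ᶠ t in 𝓝 s, heightCoord X t (X (ψ t)) = heightCoord X s (X u)) ∧
      HasDerivAt (fun t => tangentCoord X t (X (ψ t))) w s ∧
      w + 1 + heightCoord X s (X u) * tangentPart X s (deriv (deriv (deriv X)) s) =
        (tangentCoord X s (X u) + heightCoord X s (X u) *
          heightPart X s (deriv (deriv (deriv X)) s)) *
          (tangentPart X s (deriv X u) / heightPart X s (deriv X u)) := by
  obtain ⟨ψ, ψ', hψs, hψ, hlevel⟩ := hX.exists_level_curve hs hu hne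
  obtain ⟨w, hw⟩ := hX.hasDerivAt_tangentCoord_comp hs hu hψs hψ
  refine ⟨ψ, w, hψs, hψ.continuousAt, hlevel, hw, ?_⟩
  set y := heightCoord X s (X u) with hy
  have hD := hX.wedge_ne_zero s hs
  have h1 : HasDerivAt (fun t => X (ψ t)) (ψ' • deriv X u) s := by
    subst hψs; exact (hX.hasDerivAt hu).scomp s hψ
  -- Differentiating `X(ψ t) = X t + a(t) X' t + y X'' t` with `y` constant gives `ψ' X' u = X' +
  -- wX' + aX'' + yX'''` at `s`. The quotient of its two frame components eliminates `ψ'`.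
  have h2 := ((hX.hasDerivAt hs).add (hw.smul (hX.hasDerivAt_deriv hs))).add
    ((hX.hasDerivAt_deriv_deriv hs).const_smul y)
  have hev : (fun t => X (ψ t)) =ᶠ[𝓝 s] (X + (fun t => tangentCoord X t (X (ψ t))) • deriv X) +
      y • deriv (deriv X) := by
    filter_upwards [hlevel, hX.mem_nhds hs] with t ht htI
    have := frame_decomposition (hX.wedge_ne_zero t htI) (X (ψ t))
    rw [ht] at this
    exact this
  have h3 := h1.unique (h2.congr_of_eventuallyEq hev)
  rw [hψs] at h3
  have h30 := congrArg (fun v : Plane => v 0) h3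
  have h31 := congrArg (fun v : Plane => v 1) h3
  simp only [PiLp.add_apply, PiLp.smul_apply, smul_eq_mul] at h30 h31
  have e1 : ψ' * tangentPart X s (deriv X u) =
      w + 1 + y * tangentPart X s (deriv (deriv (deriv X)) s) := by
    simp only [tangentPart]
    field_simp
    simp only [wedge]
    linear_combination deriv (deriv X) s 1 * h30 - deriv (deriv X) s 0 * h31
  have e2 : ψ' * heightPart X s (deriv X u) =
      tangentCoord X s (X u) + y * heightPart X s (deriv (deriv (deriv X)) s) := by
    have : ∀ v : Plane, heightPart X s v * wedge (deriv X s) (deriv (deriv X) s) =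
        wedge (deriv X s) v := fun v => div_mul_cancel₀ _ hD
    apply mul_right_cancel₀ hD
    rw [add_mul, mul_assoc, mul_assoc, this, this]
    simp only [wedge]
    linear_combination -deriv X s 1 * h30 + deriv X s 0 * h31
  rw [← e1, ← e2]
  field_simp

/-- All chords with end points at parameter distance less than `δ` from `s` have the length of the
chords of a parabola. -/
def HasParabolicChords (X : ℝ → Plane) (s δ : ℝ) : Prop :=
  ∀ u ∈ Ioo (s - δ) s, ∀ v ∈ Ioo s (s + δ), heightCoord X s (X u) = heightCoord X s (X v) →
    (tangentCoord X s (X v) - tangentCoord X s (X u)) ^ 2 = 8 * heightCoord X s (X u)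

/-- If the chord length condition holds uniformly near `s`, the curve is a parabola near `s`. -/
theorem eventually_of_hasParabolicChords (hX : IsNondegenerateOn X I) (hs : s ∈ I) {δ : ℝ}
    (hδ : 0 < δ) (hpar : ∀ᶠ t in 𝓝 s, HasParabolicChords X t δ) :
    ∃ ρ : ℝ, ∀ᶠ u in 𝓝 s,
      (tangentCoord X s (X u) + ρ * heightCoord X s (X u)) ^ 2 = 2 * heightCoord X s (X u) := by
  have hO := hX.osculatingCoords hs
  obtain ⟨y₁, α, β, B⟩ := hO.exists_chordBranches
    (inter_mem (hX.mem_nhds hs) (Ioo_mem_nhds (sub_lt_self s hδ) (lt_add_of_pos_right s hδ)))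
  have hl : ∀ y ∈ Ioo 0 y₁, α y ∈ I ∩ Ioo (s - δ) (s + δ) := fun y hy =>
    B.subset y hy (left_mem_Icc.2 ((B.left_lt y hy).trans (B.lt_right y hy)).le)
  have hr : ∀ y ∈ Ioo 0 y₁, β y ∈ I ∩ Ioo (s - δ) (s + δ) := fun y hy =>
    B.subset y hy (right_mem_Icc.2 ((B.left_lt y hy).trans (B.lt_right y hy)).le)
  have hsq : ∀ᶠ y in 𝓝[>] 0,
      chordLength (fun u => tangentCoord X s (X u)) α β y ^ 2 = 8 * y := by
    filter_upwards [B.eventually_mem] with y hy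
    have := hpar.self_of_nhds (α y) ⟨(hl y hy).2.1, B.left_lt y hy⟩ (β y)
      ⟨B.lt_right y hy, (hr y hy).2.2⟩ ((B.apply_left y hy).trans (B.apply_right y hy).symm)
    rwa [B.apply_left y hy] at this
  set q := heightPart X s (deriv (deriv (deriv X)) s) with hq
  -- At fixed `y` the squared chord length is `8y` for every nearby tangency point, so the
  -- `a`-coordinates of both ends have the same derivative. The left sides of the two level-curve
  -- identities then agree.
  have hkey : ∀ᶠ y in 𝓝[>] 0,
      (tangentCoord X s (X (α y)) + y * q) *
        (tangentPart X s (deriv X (α y)) / heightPart X s (deriv X (α y))) =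
      (tangentCoord X s (X (β y)) + y * q) *
        (tangentPart X s (deriv X (β y)) / heightPart X s (deriv X (β y))) := by
    filter_upwards [B.eventually_mem, hO.eventually_chordLength_pos B] with y hy hpos
    obtain ⟨ψ, w, hψs, hψ, hψY, hw, hwe⟩ := hX.exists_level_curve_tangentCoord hs (hl y hy).1
      (B.deriv_left_neg y hy).ne
    obtain ⟨φ, z, hφs, hφ, hφY, hz, hze⟩ := hX.exists_level_curve_tangentCoord hs (hr y hy).1
      (B.deriv_right_pos y hy).ne'
    rw [B.apply_left y hy] at hwe hψY
    rw [B.apply_right y hy] at hze hφY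
    have hconst : (fun t => (tangentCoord X t (X (φ t)) - tangentCoord X t (X (ψ t))) ^ 2)
        =ᶠ[𝓝 s] fun _ => 8 * y := by
      have c1 := hψ.eventually_lt continuousAt_id (by rw [hψs]; exact B.left_lt y hy)
      have c2 := continuousAt_id.eventually_lt hφ (by rw [hφs]; exact B.lt_right y hy)
      have c3 := (continuousAt_id.sub_const δ).eventually_lt hψ
        (by rw [hψs]; exact (hl y hy).2.1)
      have c4 := hφ.eventually_lt (continuousAt_id.add_const δ)
        (by rw [hφs]; exact (hr y hy).2.2)
      filter_upwards [hpar, hψY, hφY, c1, c2, c3, c4] with t h1 h2 h3 c1 c2 c3 c4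
      have := h1 (ψ t) ⟨c3, c1⟩ (φ t) ⟨c2, c4⟩ (h2.trans h3.symm)
      rw [this, h2]
    have hd := ((hz.fun_sub hw).fun_pow 2).unique
      ((hasDerivAt_const s (8 * y)).congr_of_eventuallyEq hconst)
    rw [hψs, hφs] at hd
    have hpos' : 0 < tangentCoord X s (X (β y)) - tangentCoord X s (X (α y)) := hpos
    have hzw : z - w = 0 := by
      norm_num at hd
      rcases hd with hd | hd
      · exact absurd hd hpos'.ne'
      · exact hd
    rw [← hwe, ← hze]
    linarith
  -- The relation `hkey` is `a_β a_β' - a_α a_α' + q y L' = 0`. Since `L = 2yL'`, one has `(yL)' =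
  -- 3yL'`, which explains the factor `q / 3` in the primitive.
  have hM : ∀ᶠ y in 𝓝[>] 0, (tangentCoord X s (X (β y)) ^ 2 - tangentCoord X s (X (α y)) ^ 2) / 2 +
      q / 3 * (y * chordLength (fun u => tangentCoord X s (X u)) α β y) = 0 := by
    refine OsculatingCoords.eventually_eq_of_hasDerivAt_zero (f := fun y =>
      (tangentCoord X s (X (β y)) ^ 2 - tangentCoord X s (X (α y)) ^ 2) / 2 +
      q / 3 * (y * chordLength (fun u => tangentCoord X s (X u)) α β y)) ?_ ?_
    · filter_upwards [hkey, hO.eventually_hasDerivAt_left B, hO.eventually_hasDerivAt_right B,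
        hO.eventually_hasDerivAt_chordLength B, (hO.eventually_chordLength_sq_iff B).1 hsq]
        with y h1 h2 h3 h4 h5
      refine ((((h3.fun_pow 2).fun_sub (h2.fun_pow 2)).div_const 2).fun_add
        (((hasDerivAt_id' y).fun_mul h4).const_mul (q / 3))).congr_deriv ?_
      rw [h5, chordRate]
      norm_num
      linear_combination -h1
    · have hα := hO.tendsto_A.comp B.tendsto_left
      have hβ := hO.tendsto_A.comp B.tendsto_right
      have hy : Tendsto (fun y : ℝ => y) (𝓝[>] 0) (𝓝 0) := tendsto_id.mono_left nhdsWithin_le_nhds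
      have := (((hβ.pow 2).sub (hα.pow 2)).div_const 2).add
        ((hy.mul (hβ.sub hα)).const_mul (q / 3))
      simpa [chordLength, Function.comp_def] using this
  refine ⟨q / 3, hO.eventually_of_left_or_right B hsq (Or.inl ?_)⟩
  rw [hO.eventually_left_iff B]
  filter_upwards [hM, (hO.eventually_chordLength_sq_iff_eq_sqrt B).1 hsq,
    hO.eventually_chordLength_pos B] with y h1 h2 h3
  rw [chordLength] at h1 h2 h3
  -- Dividing the primitive by `L > 0` gives the midpoint of the chord; midpoint and length
  -- determine both ends.
  have h4 : (tangentCoord X s (X (β y)) + tangentCoord X s (X (α y))) / 2 + q / 3 * y = 0 := by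
    have : (tangentCoord X s (X (β y)) - tangentCoord X s (X (α y))) *
        ((tangentCoord X s (X (β y)) + tangentCoord X s (X (α y))) / 2 + q / 3 * y) = 0 := by
      linear_combination h1
    exact (mul_eq_zero.1 this).resolve_left h3.ne'
  linarith

end IsNondegenerateOn

end

end CentroidParabola

/-! ### From pointwise to uniform chord conditions by Baire category. -/

namespace CentroidParabola

noncomputable section

namespace IsNondegenerateOn

variable {X : ℝ → Plane} {I : Set ℝ} {s : ℝ}

/-- The map `v ↦ heightPart X t (deriv X v)` vanishes at `t` and is strictly increasing on an
interval independent of `t`. Level curves therefore exist through all chord ends in that interval.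
-/
theorem exists_heightPart_deriv_ne_zero (hX : IsNondegenerateOn X I) (hs : s ∈ I) :
    ∃ ε > 0, Ioo (s - ε) (s + ε) ⊆ I ∧ ∀ t ∈ Ioo (s - ε) (s + ε), ∀ u ∈ Ioo (s - ε) (s + ε),
      u ≠ t → heightPart X t (deriv X u) ≠ 0 := by
  have hc : ContinuousAt (fun z : ℝ × ℝ => heightPart X z.1 (deriv (deriv X) z.2)) (s, s) := by
    have h3 : ContDiffAt ℝ 1 (fun z : ℝ × ℝ => deriv X z.1) (s, s) :=
      ((hX.contDiffAt_deriv hs).of_le (by norm_num)).comp (s, s) contDiffAt_fst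
    have h4 : ContDiffAt ℝ 1 (fun z : ℝ × ℝ => deriv (deriv X) z.1) (s, s) :=
      (hX.contDiffAt_deriv_deriv hs).comp (s, s) contDiffAt_fst
    have h5 : ContDiffAt ℝ 1 (fun z : ℝ × ℝ => deriv (deriv X) z.2) (s, s) :=
      (hX.contDiffAt_deriv_deriv hs).comp (s, s) contDiffAt_snd
    exact ((contDiffAt_wedge h3 h5).div (contDiffAt_wedge h3 h4)
      (hX.wedge_ne_zero s hs)).continuousAt
  have hpos : (0 : ℝ) < heightPart X s (deriv (deriv X) s) := by
    rw [heightPart, div_self (hX.wedge_ne_zero s hs)]; exact one_pos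
  have hev : ∀ᶠ z in 𝓝 (s, s), 0 < heightPart X z.1 (deriv (deriv X) z.2) :=
    hc.tendsto.eventually_const_lt hpos
  rw [Metric.eventually_nhds_iff] at hev
  obtain ⟨ε₁, hε₁, h1⟩ := hev
  obtain ⟨ε₂, hε₂, h2⟩ := Metric.mem_nhds_iff.1 (hX.mem_nhds hs)
  have hsub : Ioo (s - min ε₁ ε₂) (s + min ε₁ ε₂) ⊆ I := by
    rw [← Real.ball_eq_Ioo]
    exact (Metric.ball_subset_ball (min_le_right _ _)).trans h2
  refine ⟨min ε₁ ε₂, lt_min hε₁ hε₂, hsub, ?_⟩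
  intro t ht u hu hne
  have hd : ∀ v ∈ Ioo (s - min ε₁ ε₂) (s + min ε₁ ε₂),
      HasDerivAt (fun v => heightPart X t (deriv X v)) (heightPart X t (deriv (deriv X) v)) v := by
    intro v hv
    refine ((hasDerivAt_wedge (hasDerivAt_const v (deriv X t))
      (hX.hasDerivAt_deriv (hsub hv))).div_const _).congr_deriv ?_
    simp [wedge, heightPart]
  have hmono : StrictMonoOn (fun v => heightPart X t (deriv X v))
      (Ioo (s - min ε₁ ε₂) (s + min ε₁ ε₂)) := by
    refine strictMonoOn_of_deriv_pos (convex_Ioo _ _)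
      (fun v hv => (hd v hv).continuousAt.continuousWithinAt) fun v hv => ?_
    rw [interior_Ioo] at hv
    rw [(hd v hv).deriv]
    refine h1 (y := (t, v)) ?_
    rw [← Real.ball_eq_Ioo] at ht hv
    rw [Prod.dist_eq]
    exact max_lt ((Metric.mem_ball.1 ht).trans_le (min_le_left _ _))
      ((Metric.mem_ball.1 hv).trans_le (min_le_left _ _))
  intro h0
  refine hne (hmono.injOn hu ht ?_)
  simp only [h0]
  rw [heightPart, wedge_self, zero_div]

/-- Close to `s`, each parameter is the branch value at its own height, so two parameters on
opposite sides at equal height are the ends of one chord. -/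
theorem exists_hasParabolicChords (hX : IsNondegenerateOn X I) (hs : s ∈ I) {U : Set ℝ}
    {y₁ : ℝ} {α β : ℝ → ℝ}
    (B : ChordBranches (fun u => heightCoord X s (X u)) (fun u => heightPart X s (deriv X u))
      U s y₁ α β)
    (hsq : ∀ᶠ y in 𝓝[>] 0, chordLength (fun u => tangentCoord X s (X u)) α β y ^ 2 = 8 * y) :
    ∃ δ > 0, HasParabolicChords X s δ := by
  have hO := hX.osculatingCoords hs
  have hl := B.left_inv.and ((hO.tendsto_Y_left B).eventually hsq)
  obtain ⟨a, ha, hla⟩ := mem_nhdsLT_iff_exists_Ioo_subset.1 hl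
  obtain ⟨b, hb, hrb⟩ := mem_nhdsGT_iff_exists_Ioo_subset.1 B.right_inv
  refine ⟨min (s - a) (b - s), lt_min (sub_pos.2 ha) (sub_pos.2 hb), ?_⟩
  intro u hu v hv huv
  have h1 := min_le_left (s - a) (b - s)
  have h2 := min_le_right (s - a) (b - s)
  obtain ⟨⟨-, hu1⟩, hu2⟩ := hla (⟨by linarith [hu.1], hu.2⟩ : u ∈ Ioo a s)
  obtain ⟨-, hv1⟩ := hrb (⟨hv.1, by linarith [hv.2]⟩ : v ∈ Ioo s b)
  rw [← huv] at hv1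
  rwa [chordLength, hu1, hv1] at hu2

/-- If every point has parabolic chords, some point has them uniformly in a neighbourhood. -/
theorem exists_eventually_hasParabolicChords (hX : IsNondegenerateOn X I) (hI : I.Nonempty)
    (hpar : ∀ s ∈ I, ∃ δ > 0, HasParabolicChords X s δ) :
    ∃ s ∈ I, ∃ δ > 0, ∀ᶠ t in 𝓝 s, HasParabolicChords X t δ := by
  obtain ⟨s₀, hs₀⟩ := hI
  obtain ⟨ε, hε, hsub, hne⟩ := hX.exists_heightPart_deriv_ne_zero hs₀
  set J := Ioo (s₀ - ε / 2) (s₀ + ε / 2) with hJ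
  have hJI : J ⊆ I := (Ioo_subset_Ioo (by linarith) (by linarith)).trans hsub
  have hs₀J : s₀ ∈ J := ⟨by linarith, by linarith⟩
  set d : ℕ → ℝ := fun n => ε / 2 / (n + 1) with hd
  have hdpos : ∀ n, 0 < d n := fun n => by positivity
  have hdle : ∀ n, d n ≤ ε / 2 := fun n =>
    div_le_self (by positivity) (by linarith [(Nat.cast_nonneg n : (0 : ℝ) ≤ n)])
  have : LocallyCompactSpace J := isOpen_Ioo.locallyCompactSpace
  have : Nonempty J := ⟨⟨s₀, hs₀J⟩⟩
  -- A chord violating the length condition persists when the tangency point moves: its ends follow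
  -- the level curves, and the strict inequalities and the wrong length survive by continuity.
  have hopen : ∀ n, ∀ t ∈ J, ¬ HasParabolicChords X t (d n) →
      ∀ᶠ t' in 𝓝 t, ¬ HasParabolicChords X t' (d n) := by
    intro n t ht hnot
    unfold HasParabolicChords at hnot
    push Not at hnot
    obtain ⟨u, hu, v, hv, huv, hlen⟩ := hnot
    have := hdle n
    have htε : t ∈ Ioo (s₀ - ε) (s₀ + ε) := ⟨by linarith [ht.1], by linarith [ht.2]⟩
    have huε : u ∈ Ioo (s₀ - ε) (s₀ + ε) :=
      ⟨by linarith [hu.1, ht.1], by linarith [hu.2, ht.2]⟩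
    have hvε : v ∈ Ioo (s₀ - ε) (s₀ + ε) :=
      ⟨by linarith [hv.1, ht.1], by linarith [hv.2, ht.2]⟩
    obtain ⟨ψ, w, hψs, hψ, hψY, hw, -⟩ := hX.exists_level_curve_tangentCoord (hsub htε) (hsub huε)
      (hne t htε u huε hu.2.ne)
    obtain ⟨φ, z, hφs, hφ, hφY, hz, -⟩ := hX.exists_level_curve_tangentCoord (hsub htε) (hsub hvε)
      (hne t htε v hvε hv.1.ne')
    have c1 := hψ.eventually_lt continuousAt_id (by rw [hψs]; exact hu.2)
    have c2 := continuousAt_id.eventually_lt hφ (by rw [hφs]; exact hv.1)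
    have c3 := (continuousAt_id.sub_const (d n)).eventually_lt hψ (by rw [hψs]; exact hu.1)
    have c4 := hφ.eventually_lt (continuousAt_id.add_const (d n)) (by rw [hφs]; exact hv.2)
    have c5 : ∀ᶠ t' in 𝓝 t, (tangentCoord X t' (X (φ t')) - tangentCoord X t' (X (ψ t'))) ^ 2 ≠
        8 * heightCoord X t (X u) :=
      ((hz.continuousAt.sub hw.continuousAt).pow 2).eventually_ne (by
        simp only [Pi.pow_apply, Pi.sub_apply, hψs, hφs]; exact hlen)
    filter_upwards [hψY, hφY, c1, c2, c3, c4, c5] with t' h1 h2 c1 c2 c3 c4 c5 hp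
    refine c5 ?_
    rw [hp (ψ t') ⟨c3, c1⟩ (φ t') ⟨c2, c4⟩ (by rw [h1, h2, huv]), h1]
  obtain ⟨n, t, ht⟩ := nonempty_interior_of_iUnion_of_closed
    (f := fun n => ((↑) : J → ℝ) ⁻¹' {t | HasParabolicChords X t (d n)}) (by
      intro n
      rw [← isOpen_compl_iff, isOpen_iff_mem_nhds]
      intro t ht
      exact continuous_subtype_val.continuousAt.tendsto.eventually (hopen n t t.2 ht)) (by
      rw [eq_univ_iff_forall]
      intro t
      obtain ⟨δ, hδ, hp⟩ := hpar t (hJI t.2)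
      obtain ⟨n, hn⟩ := exists_nat_gt (ε / 2 / δ)
      refine mem_iUnion.2 ⟨n, ?_⟩
      have hle : d n ≤ δ := by
        rw [div_lt_iff₀ hδ] at hn
        rw [hd]
        simp only
        rw [div_le_iff₀ (by positivity)]
        nlinarith
      intro u hu v hv
      exact hp u ⟨by linarith [hu.1], hu.2⟩ v ⟨hv.1, by linarith [hv.2]⟩)
  rw [mem_interior_iff_mem_nhds, preimage_coe_mem_nhds_subtype,
    isOpen_Ioo.nhdsWithin_eq t.2] at ht
  exact ⟨t, hJI t.2, d n, hdpos n, ht⟩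

/-! ### Continuation along the parabola and the equivalence. -/

/-- A curve that meets a parabola in an arc stays on it, provided that it never leaves it at the
end of an arc. -/
theorem subset_of_eventually {X : ℝ → Plane} {S : Set Plane} (hI : I.OrdConnected) (hs : s ∈ I)
    (hS : ∀ᶠ u in 𝓝 s, X u ∈ S)
    (hext : ∀ t ∈ I, ((∀ᶠ u in 𝓝[<] t, X u ∈ S) ∨ ∀ᶠ u in 𝓝[>] t, X u ∈ S) →
      ∀ᶠ u in 𝓝 t, X u ∈ S) : ∀ t ∈ I, X t ∈ S := by
  set G := {t | ∀ᶠ u in 𝓝 t, X u ∈ S} with hG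
  have hGo : IsOpen G := isOpen_iff_mem_nhds.2 fun t ht => eventually_eventually_nhds.2 ht
  have hGS : ∀ t ∈ G, X t ∈ S := fun t ht => ht.self_of_nhds
  intro t ht
  refine hGS t ?_
  by_contra htG
  rcases le_total s t with hst | hts
  -- At the first parameter `c` after `s` outside `G`, the arc to the left still lies on `S`, so
  -- `hext` puts `c` into `G`.
  · obtain ⟨c, ⟨hcI, hcG⟩, hmin⟩ := (isCompact_Icc.diff hGo).exists_isLeast
      (⟨t, ⟨hst, le_rfl⟩, htG⟩ : (Icc s t \ G).Nonempty)
    have hsc : s < c := lt_of_le_of_ne hcI.1 (by rintro rfl; exact hcG hS)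
    refine hcG (hext c (hI.out hs ht hcI) (Or.inl ?_))
    filter_upwards [Ioo_mem_nhdsLT hsc] with u hu
    refine hGS u ?_
    by_contra huG
    exact absurd (hmin ⟨⟨hu.1.le, hu.2.le.trans hcI.2⟩, huG⟩) (not_le.2 hu.2)
  · obtain ⟨c, ⟨hcI, hcG⟩, hmax⟩ := (isCompact_Icc.diff hGo).exists_isGreatest
      (⟨t, ⟨le_rfl, hts⟩, htG⟩ : (Icc t s \ G).Nonempty)
    have hsc : c < s := lt_of_le_of_ne hcI.2 (by rintro rfl; exact hcG hS)
    refine hcG (hext c (hI.out ht hs hcI) (Or.inr ?_))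
    filter_upwards [Ioo_mem_nhdsGT hsc] with u hu
    refine hGS u ?_
    by_contra huG
    exact absurd (hmax ⟨⟨hcI.1.trans hu.1.le, hu.2.le⟩, huG⟩) (not_le.2 hu.1)

/-- On the parabola `ℓ² = m` a point is determined by its value of `ℓ`. Along the curve `ℓ` has
nonzero derivative, hence takes an open set of values, and the preimage of that set under `ℓ` cuts
out the trace. -/
theorem isOpenPartOfParabola (hX : IsNondegenerateOn X I) {S : Set Plane} (hS : IsParabola S)
    (hsub : ∀ s ∈ I, X s ∈ S) : IsOpenPartOfParabola X I := by
  have hS' := hS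
  obtain ⟨c₁, c₂, c₀, d₁, d₂, d₀, hcd, rfl⟩ := (isParabola_iff S).1 hS
  have hcont : Continuous fun p : Plane => c₁ * p 0 + c₂ * p 1 + c₀ := by fun_prop
  have hd : ∀ (k₁ k₂ k₀ : ℝ), ∀ s ∈ I, HasDerivAt (fun s => k₁ * X s 0 + k₂ * X s 1 + k₀)
      (k₁ * deriv X s 0 + k₂ * deriv X s 1) s := fun k₁ k₂ k₀ s hs =>
    (((hasDerivAt_coord (hX.hasDerivAt hs) 0).const_mul k₁).add
      ((hasDerivAt_coord (hX.hasDerivAt hs) 1).const_mul k₂)).add_const k₀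
  have hstrict : ∀ s ∈ I, HasStrictDerivAt (fun s => c₁ * X s 0 + c₂ * X s 1 + c₀)
      (c₁ * deriv X s 0 + c₂ * deriv X s 1) s := by
    intro s hs
    have hX1 : ∀ i : Fin 2, ContDiffAt ℝ 1 (fun s => X s i) s := fun i =>
      (EuclideanSpace.proj (𝕜 := ℝ) i).contDiff.contDiffAt.comp s
        ((hX.contDiffAt hs).of_le (by norm_num))
    exact ((((contDiffAt_const (c := c₁)).mul (hX1 0)).add
      ((contDiffAt_const (c := c₂)).mul (hX1 1))).add (contDiffAt_const (c := c₀))).hasStrictDerivAt'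
        (hd c₁ c₂ c₀ s hs) (by norm_num)
  -- If the derivative of `ℓ` vanished, differentiating `ℓ² = m` would make that of `m` vanish too;
  -- as their linear parts are independent, the velocity would be zero.
  have hne : ∀ s ∈ I, c₁ * deriv X s 0 + c₂ * deriv X s 1 ≠ 0 := by
    intro s hs h0
    have hev : (fun s => (c₁ * X s 0 + c₂ * X s 1 + c₀) ^ 2) =ᶠ[𝓝 s]
        fun s => d₁ * X s 0 + d₂ * X s 1 + d₀ := by
      filter_upwards [hX.mem_nhds hs] with u hu using hsub u hu
    have h1 := ((hd c₁ c₂ c₀ s hs).fun_pow 2).unique ((hd d₁ d₂ d₀ s hs).congr_of_eventuallyEq hev)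
    rw [h0, mul_zero] at h1
    refine hX.deriv_ne_zero hs (plane_ext ?_ ?_) <;> apply mul_left_cancel₀ hcd <;>
      rw [PiLp.zero_apply]
    · linear_combination d₂ * h0 + c₂ * h1
    · linear_combination -d₁ * h0 - c₁ * h1
  have hK : IsOpen ((fun s => c₁ * X s 0 + c₂ * X s 1 + c₀) '' I) := by
    rw [isOpen_iff_mem_nhds]
    rintro _ ⟨s, hs, rfl⟩
    rw [← (hstrict s hs).map_nhds_eq (hne s hs)]
    exact image_mem_map (hX.mem_nhds hs)
  refine ⟨_, _, hS', hK.preimage hcont, ?_⟩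
  ext p
  constructor
  · rintro ⟨s, hs, rfl⟩
    exact ⟨hsub s hs, s, hs, rfl⟩
  · rintro ⟨hp, s, hs, hsp⟩
    refine ⟨s, hs, ?_⟩
    have hps := hsub s hs
    rw [mem_ofPred_eq] at hp hps
    simp only at hsp
    rw [hsp, hp] at hps
    apply plane_ext <;> apply mul_left_cancel₀ hcd
    · linear_combination d₂ * hsp + c₂ * hps
    · linear_combination -d₁ * hsp - c₁ * hps

end IsNondegenerateOn

namespace IsStrictlyLocallyConvex

variable {X N : ℝ → Plane} {I : Set ℝ}

theorem isOpenPartOfParabola_of_centroidDist (hX : IsStrictlyLocallyConvex X I N) (hI : IsOpen I)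
    (hI' : I.OrdConnected) (hne : I.Nonempty)
    (hc : ∀ s ∈ I, ∀ᶠ h in 𝓝[>] (0 : ℝ), IsCentroidDist X I N s h (4 / 3 * h)) :
    IsOpenPartOfParabola X I := by
  have hX' := hX.isNondegenerateOn hI
  have hpar : ∀ s ∈ I, ∃ δ > 0, IsNondegenerateOn.HasParabolicChords X s δ := by
    intro s hs
    obtain ⟨y₁, α, β, B⟩ := (hX'.osculatingCoords hs).exists_chordBranches (hX'.mem_nhds hs)
    exact hX'.exists_hasParabolicChords hs B ((hX.eventually_isCentroidDist_iff hI hs B).1 (hc s hs))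
  obtain ⟨s, hs, δ, hδ, hunif⟩ := hX'.exists_eventually_hasParabolicChords hne hpar
  obtain ⟨ρ, hρ⟩ := hX'.eventually_of_hasParabolicChords hs hδ hunif
  have hS := hX'.isParabola_of_normal_form hs ρ
  refine hX'.isOpenPartOfParabola hS (IsNondegenerateOn.subset_of_eventually hI' hs hρ ?_)
  intro t ht hside
  obtain ⟨y₁, α, β, B⟩ := (hX'.osculatingCoords ht).exists_chordBranches (hX'.mem_nhds ht)
  have hsq := (hX.eventually_isCentroidDist_iff hI ht B).1 (hc t ht)
  -- The parabola found at `s` is rewritten in the frame at `t`, for which a one-sided arc suffices;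
  -- there the chord condition at `t` carries it across.
  have hnf : ∃ r : ℝ, ∀ p, p ∈ {p | (tangentCoord X s p + ρ * heightCoord X s p) ^ 2 =
      2 * heightCoord X s p} ↔
        (tangentCoord X t p + r * heightCoord X t p) ^ 2 = 2 * heightCoord X t p := by
    rcases hside with hside | hside
    · exact hX'.exists_normal_form ht hS (l := 𝓝[<] t)
        (nhdsWithin_mono _ fun _ h => ne_of_lt h) hside
    · exact hX'.exists_normal_form ht hS (l := 𝓝[>] t)
        (nhdsWithin_mono _ fun _ h => ne_of_gt h) hside
  obtain ⟨r, hr⟩ := hnf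
  simp only [hr] at hside ⊢
  exact (hX'.osculatingCoords ht).eventually_of_left_or_right B hsq hside

theorem centroidDist_of_isOpenPartOfParabola (hX : IsStrictlyLocallyConvex X I N) (hI : IsOpen I)
    (hP : IsOpenPartOfParabola X I) {s : ℝ} (hs : s ∈ I) :
    ∀ᶠ h in 𝓝[>] (0 : ℝ), IsCentroidDist X I N s h (4 / 3 * h) := by
  have hX' := hX.isNondegenerateOn hI
  obtain ⟨S, U, hS, -, hSU⟩ := hP
  have hsub : ∀ u ∈ I, X u ∈ S := fun u hu => (hSU.le (mem_image_of_mem X hu)).1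
  have hev : ∀ᶠ u in 𝓝 s, X u ∈ S := by
    filter_upwards [hX'.mem_nhds hs] with u hu using hsub u hu
  obtain ⟨ρ, hρ⟩ := hX'.exists_normal_form hs hS le_rfl (hev.filter_mono nhdsWithin_le_nhds)
  have hO := hX'.osculatingCoords hs
  obtain ⟨y₁, α, β, B⟩ := hO.exists_chordBranches (hX'.mem_nhds hs)
  rw [hX.eventually_isCentroidDist_iff hI hs B]
  exact hO.eventually_chordLength_sq_of_eventually B (hev.mono fun u hu => (hρ _).1 hu)

end IsStrictlyLocallyConvex

end

end CentroidParabola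

theorem theorem6 (X : ℝ → CentroidParabola.Plane) (I : Set ℝ) (N : ℝ → CentroidParabola.Plane)
    (hI_open : IsOpen I) (hI_interval : I.OrdConnected) (hI_nonempty : I.Nonempty)
    (hX : CentroidParabola.IsStrictlyLocallyConvex X I N) :
    List.TFAE [
      ∃ lam mu : ℝ → ℝ, ∀ s ∈ I, ∀ᶠ h in 𝓝[>] (0 : ℝ),
        CentroidParabola.IsCentroidDist X I N s h (lam s * h ^ mu s),
      ∀ s ∈ I, ∀ᶠ h in 𝓝[>] (0 : ℝ),
        CentroidParabola.IsCentroidDist X I N s h (4 / 3 * h),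
      CentroidParabola.IsOpenPartOfParabola X I] := by
  tfae_have 1 → 2 := by
    rintro ⟨lam, mu, h⟩ s hs
    exact hX.eventually_isCentroidDist_of_rpow hI_open hs (h s hs)
  tfae_have 2 → 1 := fun h => ⟨fun _ => 4 / 3, fun _ => 1, by simpa using h⟩
  tfae_have 2 → 3 := hX.isOpenPartOfParabola_of_centroidDist hI_open hI_interval hI_nonempty
  tfae_have 3 → 2 := fun h s hs => hX.centroidDist_of_isOpenPartOfParabola hI_open h hs
  tfae_finish
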